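/- **Setting.** Let $\mathcal X$ be a measurable space with a probability measure $\mu$, and let $r:\mathcal X^2\to\{-1,1\}$ be a measurable binary relation. Let $\Phi:\mathcal X^2\to\mathcal H$ be a strongly measurable map into a real Hilbert space with $\sup_z\|\Phi(z)\|\le B$, let $K(z,z')=\langle\Phi(z),\Phi(z')\rangle$ be the corresponding kernel, and let $\mathcal H_K=\{z\mapsto\langle w,\Phi(z)\rangle : w\in\mathcal H,\ \|w\|\le 1\}$ be the unit ball of its reproducing kernel Hilbert space (it contains all kernel expansions $\sum_i\alpha_iK(\cdot,z_i)$ with $\sum_{i,j}\alpha_i\alpha_jK(z_i,z_j)\le1$). Let $X_1,\dots,X_n$ be i.i.d. with law $\mu$. Independently of them, a labeler selects $m$ of the $\binom n2$ unordered pairs of indices uniformly at random without replacement, i.e. it draws a graph $G$ uniformly among the simple graphs on $\{1,\dots,n\}$ with exactly $m$ edges (the model $G(n,m)$). Every selected pair $\{i,j\}$, presented in a fixed order $(i,j)$ that may be prescribed arbitrarily for each unordered pair, contributes the labeled example $\big((X_i,X_j),r(X_i,X_j)\big)$; the $m$ examples form the training set $D$. A learning algorithm maps every labeled data set $D$ to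 a hypothesis $h_{K,D}\in\mathcal H_K$. Let $R^1(h)=\Pr[\operatorname{sgn}h(\tilde z)\ne r(\tilde z)]$, where $\tilde z\sim\mu\otimes\mu$ and $\operatorname{sgn}0=0$, be the 0-1 risk. For $\gamma>0$ let $\widehat R^\gamma(h)=\frac1m\sum_{(z,y)\in D}\min\{\max\{0,1-y\,h(z)/\gamma\},1\}$ be the empirical ramp risk. **Theorem.** For any $n\ge2$, any $m$ with $n/2\le m\le\binom n2$, any $\gamma>0$ and any $\delta\in(0,1)$, with probability at least $1-\delta$ over the joint draw of $X_1,\dots,X_n$ and $G$, $$R^1(h_{K,D})\le\widehat R^\gamma(h_{K,D})+\frac{\sqrt{32}\,B}{\gamma\sqrt n}+\sqrt{\frac{C+1}{n}\ln\frac2\delta},\qquad C=1+\sqrt{\frac{3n}{2m}\ln\frac{2n}{\delta}}.$$ (If the event is not measurable, this means that its complement has outer probability at most $\delta$.) Moreover this is an $\tilde O(1/\sqrt n)$ rate, uniformly in $m\ge n/2$: for fixed $B,\gamma,\delta$ there is a constant $c$ such that for all $n\ge2$ and all $m\ge n/2$, $$\frac{\sqrt{32}\,B}{\gamma\sqrt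 n}+\sqrt{\frac{C+1}{n}\ln\frac2\delta}\le c\,\frac{(\ln n)^{1/4}}{\sqrt n}.$$ -/

import Mathlib

namespace BinaryRelation

open MeasureTheory ProbabilityTheory

noncomputable section

/-- The 0-1 cost of the real-valued prediction `u` for the label `y ∈ {-1, 1}`: the predicted label
is the sign of `u`, and the prediction `u = 0` counts as an error for either label. -/
def zeroOneCost (y u : ℝ) : ℝ := if Real.sign u = y then 0 else 1

/-- The ramp cost with margin `γ`. -/
def rampCost (γ y u : ℝ) : ℝ := min (max 0 (1 - y * u / γ)) 1

/-- The 0-1 risk of `h` with respect to the relation `r`: the expected 0-1 loss on a pair of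
instances drawn independently from `μ`. -/
def zeroOneRisk {𝒳 : Type*} [MeasurableSpace 𝒳] (μ : Measure 𝒳)
    (r h : 𝒳 × 𝒳 → ℝ) : ℝ :=
  ∫ z, zeroOneCost (r z) (h z) ∂(μ.prod μ)

/-- The empirical ramp risk of `h` on a labeled data set `D` (pairs of instances together with their
labels, counted with multiplicity). -/
def empRampRisk {𝒳 : Type*} (γ : ℝ) (D : Multiset ((𝒳 × 𝒳) × ℝ)) (h : 𝒳 × 𝒳 → ℝ) : ℝ :=
  (D.map fun p => rampCost γ p.2 (h p.1)).sum / (Multiset.card D : ℝ)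

/-- The kernel hypotheses for the kernel `K z z' = ⟪Φ z, Φ z'⟫`: the unit ball of its reproducing
kernel Hilbert space. It contains the expansions `∑ i, a i * K z (z i)` for which
`∑ i, ∑ j, a i * a j * K (z i) (z j) ≤ 1`. -/
def kernelHypotheses {Z H : Type*} [NormedAddCommGroup H] [InnerProductSpace ℝ H]
    (Φ : Z → H) : Set (Z → ℝ) :=
  {h | ∃ w : H, ‖w‖ ≤ 1 ∧ ∀ z, h z = inner ℝ w (Φ z)}

/-- The Erdős–Rényi model `G(n, m)`: the uniform distribution on the simple graphs with vertex set
`Fin n` and exactly `m` edges. -/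
def erdosRenyi (n m : ℕ) : Measure (SimpleGraph (Fin n)) :=
  uniformOn {G | G.edgeSet.ncard = m}

open Classical in
/-- The training set returned by a labeler that has selected the edges of the graph `G` on the
instances `x`. Each edge `e` contributes one labeled example; `o e` lists the two endpoints of `e`
in the order in which the pair is presented. -/
def trainingSet {𝒳 : Type*} {n : ℕ} (r : 𝒳 × 𝒳 → ℝ) (o : Sym2 (Fin n) → Fin n × Fin n)
    (G : SimpleGraph (Fin n)) (x : Fin n → 𝒳) : Multiset ((𝒳 × 𝒳) × ℝ) :=
  G.edgeFinset.val.map fun e =>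
    ((x (o e).1, x (o e).2), r (x (o e).1, x (o e).2))

/-- The constant `C = 1 + √((3n / (2m)) ln (2n / δ))`. -/
def samplingConst (n m : ℕ) (δ : ℝ) : ℝ :=
  1 + √(3 * (n : ℝ) / (2 * (m : ℝ)) * Real.log (2 * (n : ℝ) / δ))

/-- The excess `√32 B / (γ √n) + √((C + 1) / n * ln (2 / δ))` over the empirical risk. -/
def riskExcess (B γ δ : ℝ) (n m : ℕ) : ℝ :=
  √32 * B / (γ * √(n : ℝ)) +
    √((samplingConst n m δ + 1) / (n : ℝ) * Real.log (2 / δ))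

end

end BinaryRelation

namespace BinaryRelation

open MeasureTheory ProbabilityTheory

/-! For labels ±1 the 0-1 cost is at most the ramp cost, a `[0,1]`-valued and `1/γ`-Lipschitz
function of the prediction. It therefore suffices to bound, uniformly over the unit ball, the
expected ramp cost minus its average over the sampled pairs. Everything is done on the level of
moment generating functions, for the exponential of `s` times a supremum of deviations.

The i.i.d. case comes first (`integral_exp_ciSup_deviation_le`): for `k` independent draws the
generating function is at most `exp(s * 2LB/√k + s²/(8k))`. The first term bounds the mean supremum
by symmetrization and contraction, the second is the bounded difference inequality.

The actual deviation splits in two. The risk minus the average over all pairs is a U-statistic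
deviation. Following Hoeffding, the average over all pairs is the mean, over permutations of the
indices, of averages over `k = ⌊n/2⌋` disjoint pairs, and these pairs are i.i.d.; convexity of `exp`
and `sup` reduces to the i.i.d. case (`integral_exp_ciSup_pairs_le`). The average over all pairs
minus the average over the edges is, given the instances, sampling `m` elements without replacement
from a finite population. By Hoeffding's comparison this is dominated by sampling with replacement,
again the i.i.d. case (`sum_powersetCard_exp_ciSup_deviation_le`). The second bound is uniform in
the instances, so the two factors multiply.

Markov's inequality with an optimal `s` gives the tail (`exists_exponent`). Since `C ≥ 1`, it is
enough to prove the bound with `C + 1` replaced by `2`. The supremum is taken over finite classes,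
which exhaust a countable family approximating the unit ball. An excess above `1` makes the bound
trivial. -/

/-! ### Symmetrization, contraction and the mean of the supremum -/

theorem integrable_ciSup {Z J : Type*} [MeasurableSpace Z] {ν : Measure Z} [Finite J] [Nonempty J]
    {f : J → Z → ℝ} (hf : ∀ j, Integrable (f j) ν) : Integrable (fun z => ⨆ j, f j z) ν := by
  have := Fintype.ofFinite J
  refine Integrable.mono' (g := fun z => ∑ j, |f j z|)
    (integrable_finsetSum _ fun j _ => (hf j).abs) ?_ (ae_of_all _ fun z => ?_)
  · exact (AEMeasurable.iSup fun j => (hf j).aemeasurable).aestronglyMeasurable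
  · obtain ⟨j, hj⟩ := exists_eq_ciSup_of_finite (f := fun j => f j z)
    rw [← hj, Real.norm_eq_abs]
    exact Finset.single_le_sum (f := fun j => |f j z|) (fun i _ => abs_nonneg _) (Finset.mem_univ j)

theorem le_ciSup_of_finite {J : Type*} [Finite J] (f : J → ℝ) (j : J) : f j ≤ ⨆ j, f j :=
  le_ciSup (Set.finite_range f).bddAbove j

/-- One step of the contraction principle: a weighted loss may be replaced by the predictions that
it depends on in a Lipschitz way. -/
theorem ciSup_add_ciSup_sub_le {J : Type*} [Finite J] [Nonempty J] {a l t : J → ℝ}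
    (h : ∀ i j, |l i - l j| ≤ |t i - t j|) :
    (⨆ j, (a j + l j)) + ⨆ j, (a j - l j) ≤ (⨆ j, (a j + t j)) + ⨆ j, (a j - t j) := by
  obtain ⟨i, hi⟩ := exists_eq_ciSup_of_finite (f := fun j => a j + l j)
  obtain ⟨j, hj⟩ := exists_eq_ciSup_of_finite (f := fun j => a j - l j)
  rw [← hi, ← hj]
  have h1 := le_ciSup_of_finite (fun j => a j + t j) i
  have h2 := le_ciSup_of_finite (fun j => a j + t j) j
  have h3 := le_ciSup_of_finite (fun j => a j - t j) i
  have h4 := le_ciSup_of_finite (fun j => a j - t j) j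
  have h5 := (le_abs_self _).trans (h i j)
  rcases abs_cases (t i - t j) with h6 | h6 <;> linarith [h6.1]

/-- Symmetrization and contraction in one variable. -/
theorem integral_ciSup_add_sub_le {Z J : Type*} [MeasurableSpace Z] (ν : Measure Z)
    [IsProbabilityMeasure ν] [Finite J] [Nonempty J] {l t : J → Z → ℝ}
    (hl : ∀ j, Integrable (l j) ν) (ht : ∀ j, Integrable (t j) ν) {L : ℝ}
    (h : ∀ z i j, |l i z - l j z| ≤ L * |t i z - t j z|) (a : J → ℝ) :
    ∫ z, ⨆ j, (a j + (∫ y, l j y ∂ν - l j z)) ∂ν ≤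
      ∫ z, ((⨆ j, (a j + 2 * L * t j z)) + ⨆ j, (a j - 2 * L * t j z)) / 2 ∂ν := by
  have i1 : ∀ j, Integrable (fun z => a j + 2 * l j z) ν := fun j =>
    (integrable_const _).add ((hl j).const_mul 2)
  have i2 : ∀ j, Integrable (fun z => a j - 2 * l j z) ν := fun j =>
    (integrable_const _).sub ((hl j).const_mul 2)
  have i3 : ∀ j, Integrable (fun z => a j + 2 * L * t j z) ν := fun j =>
    (integrable_const _).add ((ht j).const_mul _)
  have i4 : ∀ j, Integrable (fun z => a j - 2 * L * t j z) ν := fun j =>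
    (integrable_const _).sub ((ht j).const_mul _)
  have i5 : ∀ j, Integrable (fun z => a j + (∫ y, l j y ∂ν - l j z)) ν := fun j =>
    (integrable_const _).add ((integrable_const _).sub (hl j))
  -- Jensen: the supremum of expectations is at most the expectation of the supremum. Writing `a +
  -- (E l - l)` as half of `(a + 2 E l) + (a - 2 l)` lets the two suprema be integrated at the same
  -- point, so a random sign appears without a ghost sample.
  have hA : (⨆ j, (a j + 2 * ∫ y, l j y ∂ν)) ≤ ∫ z, ⨆ j, (a j + 2 * l j z) ∂ν := by
    refine ciSup_le fun j => ?_
    have : a j + 2 * ∫ y, l j y ∂ν = ∫ z, (a j + 2 * l j z) ∂ν := by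
      rw [integral_add (integrable_const _) ((hl j).const_mul 2), integral_const_mul]; simp
    rw [this]
    exact integral_mono (i1 j) (integrable_ciSup i1) fun z =>
      le_ciSup_of_finite (fun j => a j + 2 * l j z) j
  calc ∫ z, ⨆ j, (a j + (∫ y, l j y ∂ν - l j z)) ∂ν
      ≤ ∫ z, ((⨆ j, (a j + 2 * ∫ y, l j y ∂ν)) + ⨆ j, (a j - 2 * l j z)) / 2 ∂ν := by
        refine integral_mono (integrable_ciSup i5)
          (((integrable_const _).add (integrable_ciSup i2)).div_const 2) fun z => ciSup_le fun j => ?_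
        have h1 := le_ciSup_of_finite (fun j => a j + 2 * ∫ y, l j y ∂ν) j
        have h2 := le_ciSup_of_finite (fun j => a j - 2 * l j z) j
        simp only at h1 h2 ⊢
        linarith
    _ = ((⨆ j, (a j + 2 * ∫ y, l j y ∂ν)) + ∫ z, ⨆ j, (a j - 2 * l j z) ∂ν) / 2 := by
        rw [integral_div, integral_add (integrable_const _) (integrable_ciSup i2)]; simp
    _ ≤ ((∫ z, ⨆ j, (a j + 2 * l j z) ∂ν) + ∫ z, ⨆ j, (a j - 2 * l j z) ∂ν) / 2 := by linarith
    _ = ∫ z, ((⨆ j, (a j + 2 * l j z)) + ⨆ j, (a j - 2 * l j z)) / 2 ∂ν := by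
        rw [integral_div, integral_add (integrable_ciSup i1) (integrable_ciSup i2)]
    _ ≤ _ := by
        refine integral_mono (((integrable_ciSup i1).add (integrable_ciSup i2)).div_const 2)
          (((integrable_ciSup i3).add (integrable_ciSup i4)).div_const 2) fun z => ?_
        refine div_le_div_of_nonneg_right (ciSup_add_ciSup_sub_le fun i j => ?_) (by norm_num)
        have h1 : 2 * l i z - 2 * l j z = 2 * (l i z - l j z) := by ring
        have h2 : 2 * L * t i z - 2 * L * t j z = L * (2 * (t i z - t j z)) := by ring
        rw [h1, h2, abs_mul, abs_mul, abs_mul, abs_of_pos (two_pos : (0 : ℝ) < 2)]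
        have h3 := h z i j
        nlinarith [le_abs_self L, abs_nonneg (t i z - t j z)]

theorem measurePreserving_finCons {Z : Type*} [MeasurableSpace Z] (ν : Measure Z)
    [IsProbabilityMeasure ν] (k : ℕ) :
    MeasurePreserving (fun p : Z × (Fin k → Z) => (Fin.cons p.1 p.2 : Fin (k + 1) → Z))
      (ν.prod (Measure.pi fun _ : Fin k => ν)) (Measure.pi fun _ : Fin (k + 1) => ν) := by
  have := (measurePreserving_piFinSuccAbove (fun _ : Fin (k + 1) => ν) 0).symm
  convert this using 1
  ext p i
  simp [MeasurableEquiv.piFinSuccAbove, Fin.insertNthEquiv, Fin.insertNth_zero']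

theorem measurable_finCons {Z : Type*} [MeasurableSpace Z] (k : ℕ) :
    Measurable (fun p : Z × (Fin k → Z) => (Fin.cons p.1 p.2 : Fin (k + 1) → Z)) := by
  refine measurable_pi_lambda _ fun i => ?_
  refine Fin.cases ?_ (fun i => ?_) i
  · simpa using measurable_fst
  · exact (measurable_pi_apply i).comp measurable_snd

theorem integrable_comp_finCons {Z : Type*} [MeasurableSpace Z] {ν : Measure Z}
    [IsProbabilityMeasure ν] {k : ℕ} {g : (Fin (k + 1) → Z) → ℝ}
    (hg : Integrable g (Measure.pi fun _ => ν)) :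
    Integrable (fun p : Z × (Fin k → Z) => g (Fin.cons p.1 p.2))
      (ν.prod (Measure.pi fun _ => ν)) :=
  (measurePreserving_finCons ν k).integrable_comp_of_integrable hg

theorem integral_finCons {Z : Type*} [MeasurableSpace Z] {ν : Measure Z}
    [IsProbabilityMeasure ν] {k : ℕ} {g : (Fin (k + 1) → Z) → ℝ}
    (hg : Integrable g (Measure.pi fun _ => ν)) :
    ∫ x, g x ∂(Measure.pi fun _ => ν) =
      ∫ p : Z × (Fin k → Z), g (Fin.cons p.1 p.2) ∂(ν.prod (Measure.pi fun _ => ν)) := by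
  have h := measurePreserving_finCons ν k
  conv_lhs => rw [← h.map_eq]
  rw [integral_map h.measurable.aemeasurable]
  rw [h.map_eq]; exact hg.aestronglyMeasurable

/-- The expected uniform deviation over a class of losses that are Lipschitz in the predictions of
linear functionals of norm at most one. -/
theorem integral_ciSup_inner_add_sum_le {Z J H : Type*} [MeasurableSpace Z] (ν : Measure Z)
    [IsProbabilityMeasure ν] [Finite J] [Nonempty J] [NormedAddCommGroup H] [InnerProductSpace ℝ H]
    {l : J → Z → ℝ} (hl : ∀ j, Measurable (l j)) (hl' : ∀ j z, l j z ∈ Set.Icc (0 : ℝ) 1)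
    {w : J → H} (hw : ∀ j, ‖w j‖ ≤ 1) {Φ : Z → H} {B : ℝ} (hB : ∀ z, ‖Φ z‖ ≤ B)
    (hΦ : ∀ j, Measurable fun z => (inner ℝ (w j) (Φ z) : ℝ)) {L : ℝ}
    (h : ∀ z i j, |l i z - l j z| ≤ L * |(inner ℝ (w i) (Φ z) : ℝ) - inner ℝ (w j) (Φ z)|)
    -- The vector `v` collects the signed terms `± 2LΦ(z)` of the coordinates already treated; it is
    -- general so that the induction can apply at both `v + u` and `v - u`.
    (k : ℕ) : ∀ v : H,
    ∫ x : Fin k → Z, ⨆ j, ((inner ℝ (w j) v : ℝ) + ∑ i, (∫ y, l j y ∂ν - l j (x i)))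
      ∂(Measure.pi fun _ => ν) ≤ √(‖v‖ ^ 2 + k * (2 * L * B) ^ 2) := by
  have hwi : ∀ j v, (inner ℝ (w j) v : ℝ) ≤ ‖v‖ := fun j v =>
    (real_inner_le_norm _ _).trans (mul_le_of_le_one_left (norm_nonneg _) (hw j))
  have il : ∀ j, Integrable (l j) ν := fun j =>
    Integrable.of_mem_Icc 0 1 (hl j).aemeasurable (ae_of_all _ (hl' j))
  have it : ∀ j, Integrable (fun z => (inner ℝ (w j) (Φ z) : ℝ)) ν := fun j => by
    refine Integrable.of_bound (hΦ j).aestronglyMeasurable B (ae_of_all _ fun z => ?_)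
    exact (norm_inner_le_norm _ _).trans
      ((mul_le_of_le_one_left (norm_nonneg _) (hw j)).trans (hB z))
  have isum : ∀ (k : ℕ) (j : J) (v : H), Integrable (fun x : Fin k → Z =>
      (inner ℝ (w j) v : ℝ) + ∑ i, (∫ y, l j y ∂ν - l j (x i))) (Measure.pi fun _ => ν) := by
    intro k j v
    refine (integrable_const _).add (integrable_finsetSum _ fun i _ =>
      (integrable_const _).sub ?_)
    exact (measurePreserving_eval (fun _ : Fin k => ν) i).integrable_comp_of_integrable (il j)
  induction k with
  | zero =>
    intro v
    simp only [Finset.univ_eq_empty, Finset.sum_empty, add_zero, CharP.cast_eq_zero, zero_mul,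
      integral_const, probReal_univ, smul_eq_mul, one_mul]
    rw [Real.sqrt_sq (norm_nonneg _)]
    exact ciSup_le fun j => hwi j v
  | succ k ih =>
    intro v
    have iS := integrable_ciSup fun j => isum (k + 1) j v
    rw [integral_finCons iS]
    have iS' := integrable_comp_finCons iS
    rw [integral_prod_symm _ iS']
    simp only [Fin.sum_univ_succ, Fin.cons_zero, Fin.cons_succ] at iS' ⊢
    have e : ∀ (j : J) (z : Z) (x : Fin k → Z), (inner ℝ (w j) v : ℝ) +
        (∫ y, l j y ∂ν - l j z + ∑ i, (∫ y, l j y ∂ν - l j (x i))) =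
        ((inner ℝ (w j) v : ℝ) + ∑ i, (∫ y, l j y ∂ν - l j (x i))) + (∫ y, l j y ∂ν - l j z) :=
      fun j z x => by ring
    simp only [e] at iS' ⊢
    have isum' : ∀ s : ℝ, Integrable (fun p : Z × (Fin k → Z) => ⨆ j,
        (((inner ℝ (w j) v : ℝ) + ∑ i, (∫ y, l j y ∂ν - l j (p.2 i))) +
          s * inner ℝ (w j) (Φ p.1))) (ν.prod (Measure.pi fun _ => ν)) := by
      intro s
      refine integrable_ciSup fun j => ((isum k j v).comp_snd ν).add ?_
      exact ((it j).const_mul s).comp_fst _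
    have ipm : Integrable (fun p : Z × (Fin k → Z) => ((⨆ j,
        (((inner ℝ (w j) v : ℝ) + ∑ i, (∫ y, l j y ∂ν - l j (p.2 i))) +
          2 * L * inner ℝ (w j) (Φ p.1))) + ⨆ j,
        (((inner ℝ (w j) v : ℝ) + ∑ i, (∫ y, l j y ∂ν - l j (p.2 i))) -
          2 * L * inner ℝ (w j) (Φ p.1))) / 2) (ν.prod (Measure.pi fun _ => ν)) := by
      have := ((isum' (2 * L)).add (isum' (-(2 * L)))).div_const 2
      simpa only [neg_mul, ← sub_eq_add_neg, Pi.add_apply] using this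
    calc _ ≤ ∫ x : Fin k → Z, ∫ z, ((⨆ j,
        (((inner ℝ (w j) v : ℝ) + ∑ i, (∫ y, l j y ∂ν - l j (x i))) +
          2 * L * inner ℝ (w j) (Φ z))) + ⨆ j,
        (((inner ℝ (w j) v : ℝ) + ∑ i, (∫ y, l j y ∂ν - l j (x i))) -
          2 * L * inner ℝ (w j) (Φ z))) / 2 ∂ν ∂(Measure.pi fun _ => ν) :=
          integral_mono iS'.integral_prod_right ipm.integral_prod_right fun x =>
            integral_ciSup_add_sub_le ν il it h
              fun j => (inner ℝ (w j) v : ℝ) + ∑ i, (∫ y, l j y ∂ν - l j (x i))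
      _ = ∫ z, ∫ x : Fin k → Z, ((⨆ j,
        (((inner ℝ (w j) v : ℝ) + ∑ i, (∫ y, l j y ∂ν - l j (x i))) +
          2 * L * inner ℝ (w j) (Φ z))) + ⨆ j,
        (((inner ℝ (w j) v : ℝ) + ∑ i, (∫ y, l j y ∂ν - l j (x i))) -
          2 * L * inner ℝ (w j) (Φ z))) / 2 ∂(Measure.pi fun _ => ν) ∂ν := by
          rw [← integral_prod_symm _ ipm, integral_prod _ ipm]
      _ ≤ ∫ z, √(‖v‖ ^ 2 + (k + 1 : ℕ) * (2 * L * B) ^ 2) ∂ν := by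
          refine integral_mono ipm.integral_prod_left (integrable_const _) fun z => ?_
          set u := (2 * L) • Φ z with hu
          have e1 : ∀ (j : J) (s : ℝ), ((inner ℝ (w j) v : ℝ) + s) + 2 * L * inner ℝ (w j) (Φ z) =
              inner ℝ (w j) (v + u) + s := fun j s => by
            rw [inner_add_right, hu, inner_smul_right]; ring
          have e2 : ∀ (j : J) (s : ℝ), ((inner ℝ (w j) v : ℝ) + s) - 2 * L * inner ℝ (w j) (Φ z) =
              inner ℝ (w j) (v - u) + s := fun j s => by
            rw [inner_sub_right, hu, inner_smul_right]; ring
          simp only [e1, e2]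
          rw [integral_div, integral_add (integrable_ciSup fun j => isum k j _)
            (integrable_ciSup fun j => isum k j _)]
          have h1 := ih (v + u)
          have h2 := ih (v - u)
          have hun : ‖u‖ ^ 2 ≤ (2 * L * B) ^ 2 := by
            rw [hu, norm_smul, mul_pow, Real.norm_eq_abs, sq_abs, mul_pow (2 * L) B]
            exact mul_le_mul_of_nonneg_left
              (pow_le_pow_left₀ (norm_nonneg _) (hB z) 2) (sq_nonneg _)
          -- The square of the mean of the two roots is at most the mean of their squares, which by
          -- the parallelogram law is `‖v‖² + ‖u‖² + kD ≤ ‖v‖² + (k+1)D`.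
          set D := (2 * L * B) ^ 2 with hD
          have hD0 : 0 ≤ D := sq_nonneg _
          have hkD : 0 ≤ (k : ℝ) * D := by positivity
          refine (div_le_div_of_nonneg_right (add_le_add h1 h2) zero_le_two).trans ?_
          apply Real.le_sqrt_of_sq_le
          have p1 := Real.sq_sqrt (show 0 ≤ ‖v + u‖ ^ 2 + k * D by positivity)
          have p2 := Real.sq_sqrt (show 0 ≤ ‖v - u‖ ^ 2 + k * D by positivity)
          have p3 := parallelogram_law_with_norm ℝ v u
          push_cast
          nlinarith [sq_nonneg (√(‖v + u‖ ^ 2 + k * D) - √(‖v - u‖ ^ 2 + k * D))]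
      _ = _ := by simp

/-! ### Bounded differences and the i.i.d. generating function -/

/-- The moment generating function form of McDiarmid's bounded difference inequality. -/
theorem integral_exp_le_of_boundedDifferences {Z : Type*} [MeasurableSpace Z] (ν : Measure Z)
    [IsProbabilityMeasure ν] {c : ℝ} (hc : 0 ≤ c) (s : ℝ) (k : ℕ) :
    ∀ {f : (Fin k → Z) → ℝ}, Measurable f → ∀ {M : ℝ}, (∀ x, |f x| ≤ M) →
    (∀ x i z, f (Function.update x i z) ≤ f x + c) →
    ∫ x, Real.exp (s * (f x - ∫ y, f y ∂(Measure.pi fun _ => ν))) ∂(Measure.pi fun _ => ν) ≤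
      Real.exp (s ^ 2 * c ^ 2 * k / 8) := by
  induction k with
  | zero =>
    intro f hf M hM hd
    have : ∀ x, f x = f default := fun x => congrArg f (Subsingleton.elim _ _)
    simp [this]
  | succ k ih =>
    intro f hf M hM hd
    have hZ : Nonempty Z := nonempty_of_isProbabilityMeasure ν
    set P : Measure (Fin k → Z) := Measure.pi fun _ => ν with hP
    have hfc : Measurable fun p : Z × (Fin k → Z) => f (Fin.cons p.1 p.2) :=
      hf.comp (measurable_finCons k)
    have ifc : Integrable (fun p : Z × (Fin k → Z) => f (Fin.cons p.1 p.2)) (ν.prod P) :=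
      Integrable.of_bound hfc.aestronglyMeasurable M (ae_of_all _ fun p => hM _)
    have ix : ∀ x : Fin k → Z, Integrable (fun z => f (Fin.cons z x)) ν := fun x =>
      Integrable.of_bound (hfc.comp measurable_prodMk_right).aestronglyMeasurable M
        (ae_of_all _ fun p => hM _)
    have ifull : Integrable f (Measure.pi fun _ => ν) :=
      Integrable.of_bound hf.aestronglyMeasurable M (ae_of_all _ hM)
    -- Averaging out the first coordinate keeps the mean and the bounded differences. Hoeffding's
    -- lemma controls `f - g` in that coordinate, the induction hypothesis controls `g`.
    set g : (Fin k → Z) → ℝ := fun x => ∫ z, f (Fin.cons z x) ∂ν with hg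
    have hgm : Measurable g := hfc.stronglyMeasurable.integral_prod_left'.measurable
    have hgM : ∀ x, |g x| ≤ M := fun x => by
      have := norm_integral_le_of_norm_le_const (μ := ν) (f := fun z => f (Fin.cons z x))
        (C := M) (ae_of_all _ fun z => hM _)
      simpa using this
    have hgd : ∀ x i z, g (Function.update x i z) ≤ g x + c := fun x i z => by
      have : g x + c = ∫ y, (f (Fin.cons y x) + c) ∂ν := by
        rw [integral_add (ix x) (integrable_const _)]; simp [hg]
      rw [this]
      refine integral_mono (ix _) ((ix x).add (integrable_const _)) fun y => ?_
      have := hd (Fin.cons y x) i.succ z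
      rwa [← Fin.cons_update] at this
    have hgint : ∫ x, f x ∂(Measure.pi fun _ => ν) = ∫ x, g x ∂P := by
      rw [integral_finCons ifull, integral_prod_symm _ ifc]
    have hM0 : ∀ u : ℝ, |u| ≤ M → |s * (u - ∫ x, g x ∂P)| ≤ |s| * (M + M) := fun u hu => by
      rw [abs_mul]
      refine mul_le_mul_of_nonneg_left ((abs_sub _ _).trans (add_le_add hu ?_)) (abs_nonneg _)
      have := norm_integral_le_of_norm_le_const (μ := P) (f := g) (C := M) (ae_of_all _ hgM)
      simpa using this
    have iexp : Integrable (fun x => Real.exp (s * (f x - ∫ x, g x ∂P)))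
        (Measure.pi fun _ : Fin (k + 1) => ν) := by
      refine Integrable.of_bound
        (((hf.sub_const _).const_mul s).exp).aestronglyMeasurable (Real.exp (|s| * (M + M)))
        (ae_of_all _ fun x => ?_)
      rw [Real.norm_eq_abs, Real.abs_exp]
      exact Real.exp_le_exp.2 ((le_abs_self _).trans (hM0 _ (hM x)))
    have iexpg : Integrable (fun x => Real.exp (s * (g x - ∫ x, g x ∂P))) P := by
      refine Integrable.of_bound
        (((hgm.sub_const _).const_mul s).exp).aestronglyMeasurable (Real.exp (|s| * (M + M)))
        (ae_of_all _ fun x => ?_)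
      rw [Real.norm_eq_abs, Real.abs_exp]
      exact Real.exp_le_exp.2 ((le_abs_self _).trans (hM0 _ (hgM x)))
    have hoeff : ∀ x, ∫ z, Real.exp (s * (f (Fin.cons z x) - g x)) ∂ν ≤
        Real.exp (s ^ 2 * c ^ 2 / 8) := fun x => by
      have hbdd : BddBelow (Set.range fun z => f (Fin.cons z x)) :=
        ⟨-M, by rintro _ ⟨z, rfl⟩; exact (abs_le.1 (hM _)).1⟩
      set a := ⨅ z, f (Fin.cons z x) with ha
      -- The one-sided difference bound holds between any two values of the coordinate, so the range
      -- has length at most `c`; this yields the constant `1/8`.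
      have hmem : ∀ z, f (Fin.cons z x) ∈ Set.Icc a (a + c) := fun z => by
        refine ⟨ciInf_le hbdd z, ?_⟩
        rw [← sub_le_iff_le_add]
        refine le_ciInf fun y => ?_
        have := hd (Fin.cons y x) 0 z
        rw [Fin.update_cons_zero] at this
        linarith
      have := (hasSubgaussianMGF_of_mem_Icc (μ := ν) (X := fun z => f (Fin.cons z x))
        (ix x).aemeasurable (ae_of_all _ hmem)).mgf_le s
      refine this.trans (Real.exp_le_exp.2 (le_of_eq ?_))
      simp only [add_sub_cancel_left, NNReal.coe_pow, NNReal.coe_div, coe_nnnorm, Real.norm_eq_abs,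
        abs_of_nonneg hc, NNReal.coe_ofNat]
      ring
    rw [hgint, integral_finCons iexp, integral_prod_symm _ (integrable_comp_finCons iexp)]
    calc ∫ x, ∫ z, Real.exp (s * (f (Fin.cons z x) - ∫ x, g x ∂P)) ∂ν ∂P
        ≤ ∫ x, Real.exp (s ^ 2 * c ^ 2 / 8) * Real.exp (s * (g x - ∫ x, g x ∂P)) ∂P := by
          refine integral_mono (integrable_comp_finCons iexp).integral_prod_right
            (iexpg.const_mul _) fun x => ?_
          have : ∀ z, Real.exp (s * (f (Fin.cons z x) - ∫ x, g x ∂P)) =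
              Real.exp (s * (f (Fin.cons z x) - g x)) * Real.exp (s * (g x - ∫ x, g x ∂P)) :=
            fun z => by rw [← Real.exp_add]; ring_nf
          simp only [this]
          rw [integral_mul_const]
          exact mul_le_mul_of_nonneg_right (hoeff x) (Real.exp_pos _).le
      _ = Real.exp (s ^ 2 * c ^ 2 / 8) * ∫ x, Real.exp (s * (g x - ∫ x, g x ∂P)) ∂P :=
          integral_const_mul _ _
      _ ≤ Real.exp (s ^ 2 * c ^ 2 / 8) * Real.exp (s ^ 2 * c ^ 2 * k / 8) :=
          mul_le_mul_of_nonneg_left (ih hgm hgM hgd) (Real.exp_pos _).le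
      _ = _ := by rw [← Real.exp_add]; push_cast; ring_nf

/-- The moment generating function of the largest deviation of an empirical mean of `k` independent
losses from the expected loss. -/
theorem integral_exp_ciSup_deviation_le {Z J H : Type*} [MeasurableSpace Z] (ν : Measure Z)
    [IsProbabilityMeasure ν] [Finite J] [Nonempty J] [NormedAddCommGroup H] [InnerProductSpace ℝ H]
    {l : J → Z → ℝ} (hl : ∀ j, Measurable (l j)) (hl' : ∀ j z, l j z ∈ Set.Icc (0 : ℝ) 1)
    {w : J → H} (hw : ∀ j, ‖w j‖ ≤ 1) {Φ : Z → H} {B : ℝ} (hB : ∀ z, ‖Φ z‖ ≤ B)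
    (hΦ : ∀ j, Measurable fun z => (inner ℝ (w j) (Φ z) : ℝ)) {L : ℝ} (hL : 0 ≤ L)
    (h : ∀ z i j, |l i z - l j z| ≤ L * |(inner ℝ (w i) (Φ z) : ℝ) - inner ℝ (w j) (Φ z)|)
    {k : ℕ} (hk : 0 < k) {s : ℝ} (hs : 0 ≤ s) :
    ∫ x : Fin k → Z, Real.exp (s * ⨆ j, (∫ y, l j y ∂ν - (∑ i, l j (x i)) / k))
      ∂(Measure.pi fun _ => ν) ≤
      Real.exp (s * (2 * L * B / √k) + s ^ 2 / 8 * (1 / k)) := by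
  have hk' : (0 : ℝ) < k := by exact_mod_cast hk
  have hZ : Nonempty Z := nonempty_of_isProbabilityMeasure ν
  have hB0 : 0 ≤ B := (norm_nonneg _).trans (hB hZ.some)
  set P : Measure (Fin k → Z) := Measure.pi fun _ => ν with hP
  set f : (Fin k → Z) → ℝ := fun x => ⨆ j, (∫ y, l j y ∂ν - (∑ i, l j (x i)) / k) with hf
  have hE : ∀ j, ∫ y, l j y ∂ν ∈ Set.Icc (0 : ℝ) 1 := fun j => by
    refine ⟨integral_nonneg fun z => (hl' j z).1, ?_⟩
    have := integral_mono (μ := ν) (Integrable.of_mem_Icc 0 1 (hl j).aemeasurable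
      (ae_of_all _ (hl' j))) (integrable_const (1 : ℝ)) fun z => (hl' j z).2
    simpa using this
  have hfm : Measurable f := Measurable.iSup fun j => by fun_prop
  have hfM : ∀ x, |f x| ≤ 1 := fun x => by
    obtain ⟨j, hj⟩ := exists_eq_ciSup_of_finite (f := fun j => ∫ y, l j y ∂ν - (∑ i, l j (x i)) / k)
    have h0 : 0 ≤ (∑ i, l j (x i)) / k :=
      div_nonneg (Finset.sum_nonneg fun i _ => (hl' j _).1) hk'.le
    have h1 : (∑ i, l j (x i)) / k ≤ 1 := by
      rw [div_le_one hk']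
      have := Finset.sum_le_card_nsmul Finset.univ (fun i => l j (x i)) 1 fun i _ => (hl' j _).2
      simpa using this
    simp only [hf]
    rw [← hj, abs_le]
    constructor <;> linarith [(hE j).1, (hE j).2]
  have hfd : ∀ x i z, f (Function.update x i z) ≤ f x + 1 / k := fun x i z => by
    refine ciSup_le fun j => ?_
    have h1 := le_ciSup_of_finite (fun j => ∫ y, l j y ∂ν - (∑ i, l j (x i)) / k) j
    have h2 : (∑ i', l j (x i')) ≤ (∑ i', l j (Function.update x i z i')) + 1 := by
      rw [← Finset.add_sum_erase _ _ (Finset.mem_univ i),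
        ← Finset.add_sum_erase Finset.univ (fun i' => l j (Function.update x i z i'))
          (Finset.mem_univ i)]
      have : ∑ i' ∈ Finset.univ.erase i, l j (Function.update x i z i') =
          ∑ i' ∈ Finset.univ.erase i, l j (x i') := Finset.sum_congr rfl fun i' hi' => by
        rw [Function.update_of_ne (Finset.ne_of_mem_erase hi')]
      rw [this]
      linarith [(hl' j (x i)).2, (hl' j (Function.update x i z i)).1]
    have h3 : (∑ i', l j (x i')) / k ≤ (∑ i', l j (Function.update x i z i')) / k + 1 / k := by
      rw [← add_div]; exact div_le_div_of_nonneg_right h2 hk'.le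
    simp only [hf] at h1 ⊢
    linarith
  have hmean : ∫ x, f x ∂P ≤ 2 * L * B / √k := by
    -- With `v = 0` the unnormalized mean supremum is at most `√k * 2LB`; dividing by `k` gives the
    -- claim.
    have h1 := integral_ciSup_inner_add_sum_le ν hl hl' hw hB hΦ h k 0
    have h2 : ∀ x : Fin k → Z, (⨆ j, ((inner ℝ (w j) (0 : H) : ℝ) +
        ∑ i, (∫ y, l j y ∂ν - l j (x i)))) = k * f x := fun x => by
      simp only [hf]
      rw [Real.mul_iSup_of_nonneg hk'.le]
      refine iSup_congr fun j => ?_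
      rw [Finset.sum_sub_distrib]
      simp
      field_simp
    simp only [h2] at h1
    rw [integral_const_mul, norm_zero, zero_pow two_ne_zero, zero_add,
      Real.sqrt_mul hk'.le, Real.sqrt_sq (by positivity)] at h1
    rw [le_div_iff₀ (Real.sqrt_pos.2 hk')]
    refine le_of_mul_le_mul_left ?_ (Real.sqrt_pos.2 hk')
    calc √k * ((∫ x, f x ∂P) * √k) = (√k * √k) * ∫ x, f x ∂P := by ring
      _ = k * ∫ x, f x ∂P := by rw [Real.mul_self_sqrt hk'.le]
      _ ≤ _ := h1
  have hmgf := integral_exp_le_of_boundedDifferences ν (c := 1 / k) (by positivity) s k hfm hfM hfd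
  have hsplit : ∀ x, Real.exp (s * f x) =
      Real.exp (s * (f x - ∫ y, f y ∂P)) * Real.exp (s * ∫ y, f y ∂P) := fun x => by
    rw [← Real.exp_add]; ring_nf
  change ∫ x, Real.exp (s * f x) ∂P ≤ _
  simp only [hsplit]
  rw [integral_mul_const]
  refine (mul_le_mul_of_nonneg_right hmgf (Real.exp_pos _).le).trans ?_
  rw [← Real.exp_add]
  refine Real.exp_le_exp.2 ?_
  have e : s ^ 2 * (1 / (k : ℝ)) ^ 2 * k / 8 = s ^ 2 / 8 * (1 / k) := by field_simp
  rw [e, add_comm]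
  gcongr

/-! ### Sampling without and with replacement -/

/-- The average of a function along an orbit of a transitive action is its average. -/
theorem card_mul_sum_smul_eq {G α : Type*} [Group G] [Fintype G] [Fintype α] [MulAction G α]
    [MulAction.IsPretransitive G α] (f : α → ℝ) (a : α) :
    (Fintype.card α : ℝ) * ∑ g : G, f (g • a) = Fintype.card G * ∑ b, f b := by
  have h : ∀ b : α, ∑ g : G, f (g • b) = ∑ g : G, f (g • a) := fun b => by
    obtain ⟨c, rfl⟩ := MulAction.exists_smul_eq G a b
    simp only [smul_smul]
    exact Equiv.sum_comp (Equiv.mulRight c) fun g => f (g • a)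
  calc (Fintype.card α : ℝ) * ∑ g : G, f (g • a) = ∑ b : α, ∑ g : G, f (g • b) := by simp [h]
    _ = ∑ g : G, ∑ b : α, f (g • b) := Finset.sum_comm
    _ = ∑ g : G, ∑ b : α, f b :=
        Finset.sum_congr rfl fun g _ => Equiv.sum_comp (MulAction.toPerm g) f
    _ = _ := by simp

/-- Jensen for the convex map `u ↦ exp(s * sup (c - u))`, with `u` the average of the `y i`. Both of
Hoeffding's averaging arguments use it. -/
theorem card_mul_exp_ciSup_le {ι J : Type*} [Fintype ι] [Nonempty ι] [Finite J] [Nonempty J]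
    (c : J → ℝ) (y : ι → J → ℝ) {u : J → ℝ} (hu : ∀ j, ∑ i, y i j = Fintype.card ι * u j)
    {s : ℝ} (hs : 0 ≤ s) :
    Fintype.card ι * Real.exp (s * ⨆ j, (c j - u j)) ≤ ∑ i, Real.exp (s * ⨆ j, (c j - y i j)) := by
  have hN : (0 : ℝ) < Fintype.card ι := by exact_mod_cast Fintype.card_pos
  set N : ℝ := (Fintype.card ι : ℝ) with hNdef
  have h1 : (⨆ j, (c j - u j)) ≤ ∑ i, (1 / N) * ⨆ j, (c j - y i j) := by
    refine ciSup_le fun j => ?_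
    have h2 : c j - u j = ∑ i, (1 / N) * (c j - y i j) := by
      rw [← Finset.mul_sum, Finset.sum_sub_distrib, hu]
      simp only [Finset.sum_const, Finset.card_univ, nsmul_eq_mul, ← hNdef]
      field_simp
    rw [h2]
    exact Finset.sum_le_sum fun i _ => mul_le_mul_of_nonneg_left
      (le_ciSup_of_finite (fun j => c j - y i j) j) (by positivity)
  have h3 := convexOn_exp.map_sum_le (t := Finset.univ) (w := fun _ : ι => 1 / N)
    (p := fun i => s * ⨆ j, (c j - y i j)) (fun _ _ => by positivity)
    (by simp [← hNdef, hN.ne']) (fun _ _ => Set.mem_univ _)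
  simp only [smul_eq_mul, ← Finset.mul_sum] at h3
  have h4 : s * (⨆ j, (c j - u j)) ≤ 1 / N * (s * ∑ i, ⨆ j, (c j - y i j)) := by
    refine (mul_le_mul_of_nonneg_left h1 hs).trans_eq ?_
    rw [← Finset.mul_sum]; ring
  have h5 := (Real.exp_le_exp.2 h4).trans h3
  calc N * Real.exp (s * ⨆ j, (c j - u j)) ≤ N * (1 / N * ∑ i, Real.exp (s * ⨆ j, (c j - y i j))) :=
        mul_le_mul_of_nonneg_left h5 hN.le
    _ = _ := by field_simp

/-- Hoeffding's comparison of sampling without and with replacement, for an exponential of a maximum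
of deviations. -/
theorem sum_perm_exp_ciSup_le {E J : Type*} [Fintype E] [DecidableEq E] [Finite J] [Nonempty J]
    (c : J → ℝ) (f : J → E → ℝ) {m : ℕ} (S : Fin m ↪ E) (t : Fin m → E) {s : ℝ} (hs : 0 ≤ s) :
    ∑ π : Equiv.Perm E, Real.exp (s * ⨆ j, (c j - (∑ i, f j (π (S i))) / m)) ≤
      ∑ π : Equiv.Perm E, Real.exp (s * ⨆ j, (c j - (∑ i, f j (π (t i))) / m)) := by
  rcases Nat.eq_zero_or_pos m with rfl | hm
  · simp
  have hm' : (0 : ℝ) < m := by exact_mod_cast hm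
  obtain ⟨q⟩ : Nonempty (Set.range t ↪ Fin m) := by
    classical
    exact Function.Embedding.nonempty_of_card_le (Fintype.card_range_le t)
  -- The values of `t` number at most `m`, so some permutation `ρ` of `E` carries part of the sample
  -- `S` onto them. Thus `t` is, up to `ρ`, a sample from `S` with the repetitions recorded by `θ`.
  obtain ⟨ρ, hρ⟩ := Equiv.Perm.exists_extending_pair (fun y => S (q y)) (fun y : Set.range t => y.1)
    (S.injective.comp q.injective) Subtype.val_injective
  set θ : Fin m → Fin m := fun i => q ⟨t i, i, rfl⟩
  have ht : ∀ i, t i = ρ (S (θ i)) := fun i => (hρ ⟨t i, i, rfl⟩).symm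
  simp only [ht]
  -- Substituting `π τ ρ⁻¹` for `π`, where `τ` extends the reordering `σ` of `S`, shows that `ρ` may
  -- be traded for any `σ`. Averaging over `σ` turns the sum with repetitions into the sum over `S`,
  -- and Jensen concludes.
  have e1 : ∀ σ : Equiv.Perm (Fin m),
      ∑ π : Equiv.Perm E, Real.exp (s * ⨆ j, (c j - (∑ i, f j (π (ρ (S (θ i))))) / m)) =
      ∑ π : Equiv.Perm E, Real.exp (s * ⨆ j, (c j - (∑ i, f j (π (S (σ (θ i))))) / m)) := by
    intro σ
    obtain ⟨τ, hτ⟩ := Equiv.Perm.exists_extending_pair (fun i => S i) (fun i => S (σ i))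
      S.injective (S.injective.comp σ.injective)
    rw [← Equiv.sum_comp (Equiv.mulRight (τ * ρ⁻¹))]
    refine Finset.sum_congr rfl fun π _ => ?_
    simp [hτ]
  have e2 : (Fintype.card (Equiv.Perm (Fin m)) : ℝ) *
      ∑ π : Equiv.Perm E, Real.exp (s * ⨆ j, (c j - (∑ i, f j (π (ρ (S (θ i))))) / m)) =
      ∑ π : Equiv.Perm E, ∑ σ : Equiv.Perm (Fin m),
        Real.exp (s * ⨆ j, (c j - (∑ i, f j (π (S (σ (θ i))))) / m)) := by
    rw [Finset.sum_comm, ← Finset.sum_congr rfl fun σ _ => e1 σ]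
    simp
  have hcard : (0 : ℝ) < Fintype.card (Equiv.Perm (Fin m)) := by exact_mod_cast Fintype.card_pos
  refine le_of_mul_le_mul_left ?_ hcard
  rw [e2, Finset.mul_sum]
  refine Finset.sum_le_sum fun π _ => card_mul_exp_ciSup_le c _ (fun j => ?_) hs
  rw [← Finset.sum_div, ← mul_div_assoc]
  congr 1
  rw [Finset.sum_comm]
  have h3 : ∀ i, ∑ σ : Equiv.Perm (Fin m), f j (π (S (σ (θ i)))) =
      Fintype.card (Equiv.Perm (Fin m)) * (∑ b, f j (π (S b))) / m := fun i => by
    have := card_mul_sum_smul_eq (G := Equiv.Perm (Fin m)) (fun b => f j (π (S b))) (θ i)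
    simp only [Equiv.Perm.smul_def, Fintype.card_fin] at this
    rw [eq_div_iff hm'.ne', mul_comm, this]
  simp only [h3]
  simp
  field_simp

/-- Sampling `m` elements without replacement against sampling them with replacement. -/
theorem sum_powersetCard_exp_ciSup_le {E J : Type*} [Fintype E] [DecidableEq E] [Finite J]
    [Nonempty J] (c : J → ℝ) (f : J → E → ℝ) (m : ℕ) {s : ℝ} (hs : 0 ≤ s) :
    (Fintype.card (Fin m → E) : ℝ) * ∑ T ∈ (Finset.univ : Finset E).powersetCard m,
        Real.exp (s * ⨆ j, (c j - (∑ e ∈ T, f j e) / m)) ≤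
      ((Finset.univ : Finset E).powersetCard m).card * ∑ t : Fin m → E,
        Real.exp (s * ⨆ j, (c j - (∑ i, f j (t i)) / m)) := by
  set Ψ : (Fin m → E) → ℝ := fun t => Real.exp (s * ⨆ j, (c j - (∑ i, f j (t i)) / m)) with hΨ
  set Ξ : Finset E → ℝ := fun T => Real.exp (s * ⨆ j, (c j - (∑ e ∈ T, f j e) / m)) with hΞ
  set Q := (Finset.univ : Finset E).powersetCard m
  have hP : (0 : ℝ) < Fintype.card (Equiv.Perm E) := by exact_mod_cast Fintype.card_pos
  have key : ∀ T ∈ Q, (Fintype.card (Fin m → E) : ℝ) *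
      ∑ π : Equiv.Perm E, Ξ (T.map π.toEmbedding) ≤
      Fintype.card (Equiv.Perm E) * ∑ t, Ψ t := by
    intro T hT
    have hTc : T.card = m := (Finset.mem_powersetCard.1 hT).2
    set S : Fin m ↪ E := (T.equivFinOfCardEq hTc).symm.toEmbedding.trans
      (Function.Embedding.subtype _) with hS
    have hST : ∀ g : E → ℝ, ∑ e ∈ T, g e = ∑ i, g (S i) := fun g => by
      rw [← Finset.sum_coe_sort T, ← (T.equivFinOfCardEq hTc).symm.sum_comp]
      rfl
    have h1 : ∀ π : Equiv.Perm E, Ξ (T.map π.toEmbedding) = Ψ fun i => π (S i) := fun π => by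
      simp only [hΞ, hΨ, Finset.sum_map, hST]
      rfl
    calc (Fintype.card (Fin m → E) : ℝ) * ∑ π : Equiv.Perm E, Ξ (T.map π.toEmbedding)
        -- Each subset is randomized by a uniform permutation and compared with every sequence `t`.
        -- Each `π` permutes both the `m`-subsets and the sequences, so it drops out afterwards.
        = ∑ _t : Fin m → E, ∑ π : Equiv.Perm E, Ψ fun i => π (S i) := by
          simp [h1]
      _ ≤ ∑ t : Fin m → E, ∑ π : Equiv.Perm E, Ψ fun i => π (t i) :=
          Finset.sum_le_sum fun t _ => sum_perm_exp_ciSup_le c f S t hs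
      _ = ∑ π : Equiv.Perm E, ∑ t : Fin m → E, Ψ fun i => π (t i) := Finset.sum_comm
      _ = ∑ π : Equiv.Perm E, ∑ t : Fin m → E, Ψ t :=
          Finset.sum_congr rfl fun π _ => (Equiv.arrowCongr (Equiv.refl _) π).sum_comp Ψ
      _ = _ := by simp
  have hmap : ∀ π : Equiv.Perm E, ∑ T ∈ Q, Ξ (T.map π.toEmbedding) = ∑ T ∈ Q, Ξ T := fun π =>
    Finset.sum_bij' (fun T _ => T.map π.toEmbedding) (fun T _ => T.map π.symm.toEmbedding)
      (fun T hT => by simpa [Q, Finset.mem_powersetCard] using hT)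
      (fun T hT => by simpa [Q, Finset.mem_powersetCard] using hT)
      (fun T _ => by ext; simp) (fun T _ => by ext; simp) (fun T _ => rfl)
  refine le_of_mul_le_mul_left ?_ hP
  calc (Fintype.card (Equiv.Perm E) : ℝ) * (Fintype.card (Fin m → E) * ∑ T ∈ Q, Ξ T)
      = Fintype.card (Fin m → E) * ∑ π : Equiv.Perm E, ∑ T ∈ Q, Ξ (T.map π.toEmbedding) := by
        simp only [hmap, Finset.sum_const, Finset.card_univ, nsmul_eq_mul]; ring
    _ = ∑ T ∈ Q, (Fintype.card (Fin m → E) * ∑ π : Equiv.Perm E, Ξ (T.map π.toEmbedding)) := by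
        rw [Finset.sum_comm, Finset.mul_sum]
    _ ≤ ∑ T ∈ Q, (Fintype.card (Equiv.Perm E) * ∑ t, Ψ t) := Finset.sum_le_sum key
    _ = _ := by simp only [Finset.sum_const, nsmul_eq_mul]; ring

theorem integral_uniformOn_coe_finset {Ω : Type*} [Fintype Ω] [MeasurableSpace Ω]
    [MeasurableSingletonClass Ω] {s : Finset Ω} (hs : s.Nonempty) (f : Ω → ℝ) :
    ∫ x, f x ∂(uniformOn (s : Set Ω)) = (∑ x ∈ s, f x) / s.card := by
  classical
  have := isProbabilityMeasure_uniformOn s.finite_toSet (Finset.coe_nonempty.2 hs)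
  rw [integral_fintype (Integrable.of_finite), Finset.sum_div,
    ← Finset.sum_subset (Finset.subset_univ s)]
  · refine Finset.sum_congr rfl fun x hx => ?_
    have : uniformOn (s : Set Ω) {x} = 1 / s.card := by
      have := uniformOn_apply_finset (s := s) (t := {x})
      rw [Finset.coe_singleton] at this
      rw [this, Finset.inter_singleton_of_mem hx]; simp
    rw [measureReal_def, this]
    simp [div_eq_inv_mul]
  · intro x _ hx
    have : uniformOn (s : Set Ω) {x} = 0 := by
      have := uniformOn_apply_finset (s := s) (t := {x})
      rw [Finset.coe_singleton] at this
      rw [this, Finset.inter_singleton_of_notMem hx]; simp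
    rw [measureReal_def, this]
    simp

theorem integral_uniformOn_univ {Ω : Type*} [Fintype Ω] [Nonempty Ω] [MeasurableSpace Ω]
    [MeasurableSingletonClass Ω] (f : Ω → ℝ) :
    ∫ x, f x ∂(uniformOn (Set.univ : Set Ω)) = (∑ x, f x) / Fintype.card Ω := by
  have := integral_uniformOn_coe_finset (Finset.univ_nonempty (α := Ω)) f
  rwa [Finset.coe_univ] at this

/-- The moment generating function of the largest deviation of the mean over a random `m`-subset
from the mean over the whole finite population. -/
theorem sum_powersetCard_exp_ciSup_deviation_le {E J H : Type*} [Fintype E] [Nonempty E] [Finite J]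
    [Nonempty J] [NormedAddCommGroup H] [InnerProductSpace ℝ H]
    {l : J → E → ℝ} (hl' : ∀ j z, l j z ∈ Set.Icc (0 : ℝ) 1)
    {w : J → H} (hw : ∀ j, ‖w j‖ ≤ 1) {Φ : E → H} {B : ℝ} (hB : ∀ z, ‖Φ z‖ ≤ B)
    {L : ℝ} (hL : 0 ≤ L)
    (h : ∀ z i j, |l i z - l j z| ≤ L * |(inner ℝ (w i) (Φ z) : ℝ) - inner ℝ (w j) (Φ z)|)
    {m : ℕ} (hm : 0 < m) {s : ℝ} (hs : 0 ≤ s) :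
    ∑ T ∈ (Finset.univ : Finset E).powersetCard m,
        Real.exp (s * ⨆ j, ((∑ e, l j e) / Fintype.card E - (∑ e ∈ T, l j e) / m)) ≤
      ((Finset.univ : Finset E).powersetCard m).card *
        Real.exp (s * (2 * L * B / √m) + s ^ 2 / 8 * (1 / m)) := by
  classical
  let _ : MeasurableSpace E := ⊤
  have : IsProbabilityMeasure (uniformOn (Set.univ : Set E)) :=
    isProbabilityMeasure_uniformOn Set.finite_univ Set.univ_nonempty
  have h1 := integral_exp_ciSup_deviation_le (uniformOn (Set.univ : Set E))
    (fun j => measurable_of_finite (l j)) hl' hw hB (fun j => measurable_of_finite _) hL h hm hs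
  rw [← uniformOn_pi, Set.pi_univ, integral_uniformOn_univ] at h1
  simp only [integral_uniformOn_univ] at h1
  have hc : (0 : ℝ) < Fintype.card (Fin m → E) := by exact_mod_cast Fintype.card_pos
  rw [div_le_iff₀ hc] at h1
  have h2 := sum_powersetCard_exp_ciSup_le (fun j => (∑ e, l j e) / (Fintype.card E : ℝ)) l m hs
  refine le_of_mul_le_mul_left (h2.trans ?_) hc
  refine (mul_le_mul_of_nonneg_left h1 (Nat.cast_nonneg _)).trans_eq ?_
  ring

/-! ### Pairs of instances: disjoint pairs and averaging over permutations -/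

/-- Injectivity of `Sum.elim a b` says that the `2k` indices are distinct, so the `k` pairs of
instances are i.i.d. with law `μ ⊗ μ`. -/
theorem measurePreserving_pairs {𝒳 : Type*} [MeasurableSpace 𝒳] (μ : Measure 𝒳)
    [IsProbabilityMeasure μ] {n k : ℕ} {a b : Fin k → Fin n}
    (hab : Function.Injective (Sum.elim a b)) :
    MeasurePreserving (fun (x : Fin n → 𝒳) (i : Fin k) => (x (a i), x (b i)))
      (Measure.pi fun _ => μ) (Measure.pi fun _ => μ.prod μ) := by
  have h1 : MeasurePreserving (fun (x : Fin n → 𝒳) (i : Fin k ⊕ Fin k) => x (Sum.elim a b i))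
      (Measure.pi fun _ => μ) (Measure.pi fun _ => μ) := by
    have hm : Measurable fun (x : Fin n → 𝒳) (i : Fin k ⊕ Fin k) => x (Sum.elim a b i) := by
      fun_prop
    refine ⟨hm, ?_⟩
    have h2 := (iIndepFun_pi (μ := fun _ : Fin n => μ) (X := fun _ => id)
      fun _ => aemeasurable_id).precomp hab
    have h3 := h2.map_fun_eq_pi_map fun i => (measurable_pi_apply _).aemeasurable
    rw [h3]
    congr 1
    funext i
    exact (measurePreserving_eval (fun _ : Fin n => μ) _).map_eq
  have h2 := measurePreserving_sumPiEquivProdPi (fun _ : Fin k ⊕ Fin k => μ)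
  have h3 := (measurePreserving_arrowProdEquivProdArrow 𝒳 𝒳 (Fin k) (fun _ => μ)
    (fun _ => μ)).symm
  exact (h3.comp h2).comp h1

/-- The unordered pairs of distinct indices. -/
abbrev Pairs (n : ℕ) : Type := {e : Sym2 (Fin n) // ¬ e.IsDiag}

/-- Permutations of the indices act on unordered pairs. -/
instance pairsAction (n : ℕ) : MulAction (Equiv.Perm (Fin n)) (Pairs n) where
  smul σ e := ⟨Sym2.map σ e.1, by rw [Sym2.isDiag_map σ.injective]; exact e.2⟩
  one_smul e := Subtype.ext (by change Sym2.map (⇑(1 : Equiv.Perm (Fin n))) e.1 = e.1; simp)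
  mul_smul σ τ e := Subtype.ext (by
    change Sym2.map (⇑(σ * τ)) e.1 = Sym2.map σ (Sym2.map τ e.1)
    rw [Sym2.map_map]; rfl)

theorem coe_smul_pairs {n : ℕ} (σ : Equiv.Perm (Fin n)) (e : Pairs n) :
    (σ • e).1 = Sym2.map σ e.1 := rfl

instance isPretransitive_pairs (n : ℕ) :
    MulAction.IsPretransitive (Equiv.Perm (Fin n)) (Pairs n) where
  exists_smul_eq := by
    rintro ⟨x, hx⟩ ⟨y, hy⟩
    induction x with | _ a b
    induction y with | _ c d
    rw [Sym2.mk_isDiag_iff] at hx hy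
    obtain ⟨σ, hσ⟩ := Equiv.Perm.exists_extending_pair ![a, b] ![c, d]
      (by intro i j; fin_cases i <;> fin_cases j <;> simp [hx, Ne.symm hx])
      (by intro i j; fin_cases i <;> fin_cases j <;> simp [hy, Ne.symm hy])
    refine ⟨σ, Subtype.ext ?_⟩
    rw [coe_smul_pairs]
    have h0 := hσ 0
    have h1 := hσ 1
    simp only [Matrix.cons_val_zero, Matrix.cons_val_one] at h0 h1
    simp [h0, h1]

/-- The witness is the matching `{2i, 2i+1}`. -/
theorem exists_disjoint_pairs {n k : ℕ} (hk : 2 * k ≤ n) :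
    ∃ e : Fin k → Pairs n, ∀ i j v, v ∈ (e i).1 → v ∈ (e j).1 → i = j := by
  refine ⟨fun i => ⟨s(⟨2 * i, by omega⟩, ⟨2 * i + 1, by omega⟩), by simp⟩, ?_⟩
  intro i j v hi hj
  simp only [Sym2.mem_iff] at hi hj
  ext
  rcases hi with rfl | rfl <;> rcases hj with hj | hj <;> simp only [Fin.mk.injEq] at hj <;> omega

/-- Disjoint pairs have distinct endpoints however each is ordered, so the orientation `o` needs no
compatibility with permutations of the indices. -/
theorem injective_endpoints {n k : ℕ} {e : Fin k → Pairs n}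
    (he : ∀ i j v, v ∈ (e i).1 → v ∈ (e j).1 → i = j) {o : Sym2 (Fin n) → Fin n × Fin n}
    (ho : ∀ e, s((o e).1, (o e).2) = e) :
    Function.Injective (Sum.elim (fun i => (o (e i).1).1) fun i => (o (e i).1).2) := by
  have h1 : ∀ e, (o e).1 ∈ e := fun e => by
    have := Sym2.mem_mk_left (o e).1 (o e).2
    rwa [ho e] at this
  have h2 : ∀ e, (o e).2 ∈ e := fun e => by
    have := Sym2.mem_mk_right (o e).1 (o e).2
    rwa [ho e] at this
  have h3 : ∀ e : Pairs n, (o e.1).1 ≠ (o e.1).2 := fun e => by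
    have := e.2
    rw [← ho e.1, Sym2.mk_isDiag_iff] at this
    exact this
  rintro (i | i) (j | j) hij <;> simp only [Sum.elim_inl, Sum.elim_inr] at hij
  · rw [he i j _ (h1 _) (hij ▸ h1 _)]
  · obtain rfl := he i j _ (h1 _) (hij ▸ h2 _)
    exact absurd hij (h3 _)
  · obtain rfl := he i j _ (h2 _) (hij ▸ h1 _)
    exact absurd hij.symm (h3 _)
  · rw [he i j _ (h2 _) (hij ▸ h2 _)]

theorem average_mem_Icc {ι : Type*} (s : Finset ι) {f : ι → ℝ} (hf : ∀ i, f i ∈ Set.Icc (0 : ℝ) 1)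
    {N : ℕ} (hN : s.card = N) : (∑ i ∈ s, f i) / N ∈ Set.Icc (0 : ℝ) 1 := by
  refine ⟨div_nonneg (Finset.sum_nonneg fun i _ => (hf i).1) (Nat.cast_nonneg _), ?_⟩
  refine div_le_one_of_le₀ ?_ (Nat.cast_nonneg _)
  have := Finset.sum_le_card_nsmul s f 1 fun i _ => (hf i).2
  simpa [hN] using this

theorem integral_mem_Icc {Z : Type*} [MeasurableSpace Z] {ν : Measure Z} [IsProbabilityMeasure ν]
    {f : Z → ℝ} (hf : Measurable f) (hf' : ∀ z, f z ∈ Set.Icc (0 : ℝ) 1) :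
    ∫ z, f z ∂ν ∈ Set.Icc (0 : ℝ) 1 := by
  refine ⟨integral_nonneg fun z => (hf' z).1, ?_⟩
  have := integral_mono (μ := ν) (Integrable.of_mem_Icc 0 1 hf.aemeasurable
    (ae_of_all _ hf')) (integrable_const (1 : ℝ)) fun z => (hf' z).2
  simpa using this

theorem exp_ciSup_sub_le {J : Type*} [Finite J] [Nonempty J] {a b : J → ℝ} (ha : ∀ j, a j ≤ 1)
    (hb : ∀ j, 0 ≤ b j) {s : ℝ} (hs : 0 ≤ s) :
    ‖Real.exp (s * ⨆ j, (a j - b j))‖ ≤ Real.exp s := by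
  rw [Real.norm_eq_abs, Real.abs_exp]
  refine Real.exp_le_exp.2 (mul_le_of_le_one_right hs (ciSup_le fun j => ?_))
  linarith [ha j, hb j]

section Deviation

variable {𝒳 : Type*} [MeasurableSpace 𝒳] (μ : Measure 𝒳) [IsProbabilityMeasure μ]
  {H : Type*} [NormedAddCommGroup H] [InnerProductSpace ℝ H] {J : Type*} [Finite J] [Nonempty J]
  {l : J → 𝒳 × 𝒳 → ℝ} (hl : ∀ j, Measurable (l j)) (hl' : ∀ j z, l j z ∈ Set.Icc (0 : ℝ) 1)
  {w : J → H} (hw : ∀ j, ‖w j‖ ≤ 1) {Φ : 𝒳 × 𝒳 → H} {B : ℝ} (hB : ∀ z, ‖Φ z‖ ≤ B)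
  (hΦ : ∀ j, Measurable fun z => (inner ℝ (w j) (Φ z) : ℝ)) {L : ℝ} (hL : 0 ≤ L)
  (h : ∀ z i j, |l i z - l j z| ≤ L * |(inner ℝ (w i) (Φ z) : ℝ) - inner ℝ (w j) (Φ z)|)
  {n k m : ℕ} (hk : 0 < k) (hkn : 2 * k ≤ n) (hm : 0 < m)
  {o : Sym2 (Fin n) → Fin n × Fin n} (ho : ∀ e, s((o e).1, (o e).2) = e) {s : ℝ} (hs : 0 ≤ s)

include hl hl' hw hB hΦ hL h hk hkn ho hs in
/-- The deviation of the average loss over all pairs from the risk. -/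
theorem integral_exp_ciSup_pairs_le :
    ∫ x : Fin n → 𝒳, Real.exp (s * ⨆ j, (∫ z, l j z ∂(μ.prod μ) -
      (∑ e : Pairs n, l j (x (o e.1).1, x (o e.1).2)) / Fintype.card (Pairs n)))
      ∂(Measure.pi fun _ => μ) ≤ Real.exp (s * (2 * L * B / √k) + s ^ 2 / 8 * (1 / k)) := by
  obtain ⟨e, he⟩ := exists_disjoint_pairs hkn
  have hk' : (0 : ℝ) < k := by exact_mod_cast hk
  have hEne : Nonempty (Pairs n) := ⟨e ⟨0, hk⟩⟩
  have hE : (0 : ℝ) < Fintype.card (Pairs n) := by exact_mod_cast Fintype.card_pos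
  have hG : (0 : ℝ) < Fintype.card (Equiv.Perm (Fin n)) := by exact_mod_cast Fintype.card_pos
  have hR := fun j => integral_mem_Icc (ν := μ.prod μ) (hl j) (hl' j)
  refine le_of_mul_le_mul_left ?_ hG
  rw [← integral_const_mul]
  have hint : ∀ e : Fin k → Pairs n, Integrable (fun x : Fin n → 𝒳 =>
      Real.exp (s * ⨆ j, (∫ z, l j z ∂(μ.prod μ) -
        (∑ i, l j (x (o (e i).1).1, x (o (e i).1).2)) / k))) (Measure.pi fun _ => μ) := by
    intro e
    refine Integrable.of_bound (Measurable.aestronglyMeasurable ?_) (Real.exp s)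
      (ae_of_all _ fun x => exp_ciSup_sub_le (fun j => (hR j).2)
        (fun j => (average_mem_Icc Finset.univ (fun i => hl' j _) (by simp)).1) hs)
    exact ((Measurable.iSup fun j => by fun_prop).const_mul s).exp
  have hint0 : Integrable (fun x : Fin n → 𝒳 =>
      Real.exp (s * ⨆ j, (∫ z, l j z ∂(μ.prod μ) -
        (∑ e : Pairs n, l j (x (o e.1).1, x (o e.1).2)) / Fintype.card (Pairs n))))
        (Measure.pi fun _ => μ) := by
    refine Integrable.of_bound (Measurable.aestronglyMeasurable ?_) (Real.exp s)
      (ae_of_all _ fun x => exp_ciSup_sub_le (fun j => (hR j).2)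
        (fun j => (average_mem_Icc Finset.univ (fun i => hl' j _) rfl).1) hs)
    exact ((Measurable.iSup fun j => by fun_prop).const_mul s).exp
  calc _ ≤ ∫ x : Fin n → 𝒳, ∑ σ : Equiv.Perm (Fin n),
        Real.exp (s * ⨆ j, (∫ z, l j z ∂(μ.prod μ) -
          (∑ i, l j (x (o (σ • e i).1).1, x (o (σ • e i).1).2)) / k)) ∂(Measure.pi fun _ => μ) := by
        refine integral_mono (hint0.const_mul _)
          (integrable_finsetSum _ fun σ _ => hint fun i => σ • e i) fun x => ?_
        refine card_mul_exp_ciSup_le _ _ (fun j => ?_) hs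
        rw [← Finset.sum_div, Finset.sum_comm]
        have h3 : ∀ i, ∑ σ : Equiv.Perm (Fin n), l j (x (o (σ • e i).1).1, x (o (σ • e i).1).2) =
            Fintype.card (Equiv.Perm (Fin n)) *
              ((∑ e : Pairs n, l j (x (o e.1).1, x (o e.1).2)) / Fintype.card (Pairs n)) :=
          fun i => by
            have := card_mul_sum_smul_eq (G := Equiv.Perm (Fin n))
              (fun e : Pairs n => l j (x (o e.1).1, x (o e.1).2)) (e i)
            rw [← mul_div_assoc, eq_div_iff hE.ne', mul_comm, this]
        rw [Finset.sum_congr rfl fun i _ => h3 i]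
        rw [Finset.sum_const, Finset.card_univ, Fintype.card_fin, nsmul_eq_mul]
        field_simp
    _ = ∑ σ : Equiv.Perm (Fin n), ∫ x : Fin n → 𝒳,
        Real.exp (s * ⨆ j, (∫ z, l j z ∂(μ.prod μ) -
          (∑ i, l j (x (o (σ • e i).1).1, x (o (σ • e i).1).2)) / k)) ∂(Measure.pi fun _ => μ) :=
        integral_finsetSum _ fun σ _ => hint fun i => σ • e i
    _ ≤ ∑ σ : Equiv.Perm (Fin n), Real.exp (s * (2 * L * B / √k) + s ^ 2 / 8 * (1 / k)) := by
        refine Finset.sum_le_sum fun σ _ => ?_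
        have hσ : ∀ i j v, v ∈ (σ • e i).1 → v ∈ (σ • e j).1 → i = j := by
          intro i j v hi hj
          rw [coe_smul_pairs, Sym2.mem_map] at hi hj
          obtain ⟨a, ha, rfl⟩ := hi
          obtain ⟨b, hb, hab⟩ := hj
          exact he i j a ha (σ.injective hab ▸ hb)
        have hp := measurePreserving_pairs μ (injective_endpoints hσ ho)
        refine le_trans (le_of_eq ?_)
          (integral_exp_ciSup_deviation_le (μ.prod μ) hl hl' hw hB hΦ hL h hk hs)
        rw [← hp.map_eq, integral_map hp.measurable.aemeasurable]
        exact (((Measurable.iSup fun j => by fun_prop).const_mul s).exp).aestronglyMeasurable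
    _ = _ := by simp

include hl hl' hw hB hΦ hL h hk hkn hm ho hs in
/-- The deviation of the average loss over a random set of `m` pairs from the risk. -/
theorem sum_integral_exp_ciSup_subset_le :
    ∑ T ∈ (Finset.univ : Finset (Pairs n)).powersetCard m,
      ∫ x : Fin n → 𝒳, Real.exp (s * ⨆ j, (∫ z, l j z ∂(μ.prod μ) -
        (∑ e ∈ T, l j (x (o e.1).1, x (o e.1).2)) / m)) ∂(Measure.pi fun _ => μ) ≤
      ((Finset.univ : Finset (Pairs n)).powersetCard m).card *
        Real.exp (s * (2 * L * B / √k + 2 * L * B / √m) + s ^ 2 / 8 * (1 / k + 1 / m)) := by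
  obtain ⟨e, he⟩ := exists_disjoint_pairs hkn
  have hEne : Nonempty (Pairs n) := ⟨e ⟨0, hk⟩⟩
  have hR := fun j => integral_mem_Icc (ν := μ.prod μ) (hl j) (hl' j)
  have hint : ∀ T ∈ (Finset.univ : Finset (Pairs n)).powersetCard m,
      Integrable (fun x : Fin n → 𝒳 => Real.exp (s * ⨆ j, (∫ z, l j z ∂(μ.prod μ) -
        (∑ e ∈ T, l j (x (o e.1).1, x (o e.1).2)) / m))) (Measure.pi fun _ => μ) := by
    intro T hT
    refine Integrable.of_bound (Measurable.aestronglyMeasurable ?_) (Real.exp s)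
      (ae_of_all _ fun x => exp_ciSup_sub_le (fun j => (hR j).2)
        (fun j => (average_mem_Icc T (fun i => hl' j _) (Finset.mem_powersetCard.1 hT).2).1) hs)
    exact ((Measurable.iSup fun j => by fun_prop).const_mul s).exp
  have hint0 : Integrable (fun x : Fin n → 𝒳 =>
      Real.exp (s * ⨆ j, (∫ z, l j z ∂(μ.prod μ) -
        (∑ e : Pairs n, l j (x (o e.1).1, x (o e.1).2)) / Fintype.card (Pairs n))))
        (Measure.pi fun _ => μ) := by
    refine Integrable.of_bound (Measurable.aestronglyMeasurable ?_) (Real.exp s)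
      (ae_of_all _ fun x => exp_ciSup_sub_le (fun j => (hR j).2)
        (fun j => (average_mem_Icc Finset.univ (fun i => hl' j _) rfl).1) hs)
    exact ((Measurable.iSup fun j => by fun_prop).const_mul s).exp
  rw [← integral_finsetSum _ hint]
  set N := ((Finset.univ : Finset (Pairs n)).powersetCard m).card
  set β := Real.exp (s * (2 * L * B / √m) + s ^ 2 / 8 * (1 / m))
  have hNβ : 0 ≤ N * β := mul_nonneg (Nat.cast_nonneg _) (Real.exp_pos _).le
  calc _ ≤ ∫ x : Fin n → 𝒳, (N * β) * Real.exp (s * ⨆ j, (∫ z, l j z ∂(μ.prod μ) -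
        (∑ e : Pairs n, l j (x (o e.1).1, x (o e.1).2)) / Fintype.card (Pairs n)))
        ∂(Measure.pi fun _ => μ) := by
        refine integral_mono (integrable_finsetSum _ hint) (hint0.const_mul _) fun x => ?_
        -- For fixed instances `x` the pairs form a finite population. The resulting factor does not
        -- depend on `x`, hence comes out of the integral.
        have h1 := sum_powersetCard_exp_ciSup_deviation_le (E := Pairs n)
          (l := fun j e => l j (x (o e.1).1, x (o e.1).2)) (fun j e => hl' j _) hw
          (Φ := fun e => Φ (x (o e.1).1, x (o e.1).2)) (fun e => hB _) hL (fun e => h _) hm hs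
        rw [mul_comm (N * β)]
        refine le_trans ?_ (mul_le_mul_of_nonneg_left h1 (Real.exp_pos _).le)
        rw [Finset.mul_sum]
        refine Finset.sum_le_sum fun T _ => ?_
        rw [← Real.exp_add, ← mul_add]
        refine Real.exp_le_exp.2 (mul_le_mul_of_nonneg_left (ciSup_le fun j => ?_) hs)
        have h2 := le_ciSup_of_finite (fun j => ∫ z, l j z ∂(μ.prod μ) -
          (∑ e : Pairs n, l j (x (o e.1).1, x (o e.1).2)) / Fintype.card (Pairs n)) j
        have h3 := le_ciSup_of_finite (fun j =>
          (∑ e : Pairs n, l j (x (o e.1).1, x (o e.1).2)) / Fintype.card (Pairs n) -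
          (∑ e ∈ T, l j (x (o e.1).1, x (o e.1).2)) / m) j
        linarith
    _ = (N * β) * ∫ x : Fin n → 𝒳, Real.exp (s * ⨆ j, (∫ z, l j z ∂(μ.prod μ) -
        (∑ e : Pairs n, l j (x (o e.1).1, x (o e.1).2)) / Fintype.card (Pairs n)))
        ∂(Measure.pi fun _ => μ) := integral_const_mul _ _
    _ ≤ (N * β) * Real.exp (s * (2 * L * B / √k) + s ^ 2 / 8 * (1 / k)) :=
        mul_le_mul_of_nonneg_left
          (integral_exp_ciSup_pairs_le μ hl hl' hw hB hΦ hL h hk hkn ho hs) hNβ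
    _ = _ := by
        rw [mul_assoc, ← Real.exp_add]; ring_nf

end Deviation

/-! ### The random graph as a random set of pairs, and the tail bound -/

theorem measurableSingletonClass_simpleGraph (n : ℕ) :
    MeasurableSingletonClass (SimpleGraph (Fin n)) where
  measurableSet_singleton G := by
    have : ({G} : Set (SimpleGraph (Fin n))) = SimpleGraph.Adj ⁻¹' {G.Adj} := by
      ext G'
      exact SimpleGraph.adj_inj.symm
    rw [this]
    exact SimpleGraph.measurable_adj (measurableSet_singleton _)

open Classical in
/-- The edges of a graph as a set of pairs. -/
noncomputable def graphPairs {n : ℕ} (G : SimpleGraph (Fin n)) : Finset (Pairs n) :=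
  Finset.univ.filter fun e => e.1 ∈ G.edgeSet

theorem mem_graphPairs {n : ℕ} {G : SimpleGraph (Fin n)} {e : Pairs n} :
    e ∈ graphPairs G ↔ e.1 ∈ G.edgeSet := by
  classical simp [graphPairs]

open Classical in
theorem map_graphPairs {n : ℕ} (G : SimpleGraph (Fin n)) :
    (graphPairs G).map (Function.Embedding.subtype _) = G.edgeFinset := by
  ext e
  simp only [Finset.mem_map, Function.Embedding.subtype_apply, SimpleGraph.mem_edgeFinset]
  constructor
  · rintro ⟨a, ha, rfl⟩
    exact mem_graphPairs.1 ha
  · intro he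
    exact ⟨⟨e, G.not_isDiag_of_mem_edgeSet he⟩, mem_graphPairs.2 he, rfl⟩

theorem card_graphPairs {n : ℕ} (G : SimpleGraph (Fin n)) :
    (graphPairs G).card = G.edgeSet.ncard := by
  classical
  rw [← Finset.card_map (Function.Embedding.subtype _), map_graphPairs,
    ← SimpleGraph.coe_edgeFinset, Set.ncard_coe_finset]

open Classical in
theorem sum_graphs_eq {n : ℕ} (m : ℕ) (f : Finset (Pairs n) → ℝ) :
    ∑ G ∈ (Finset.univ : Finset (SimpleGraph (Fin n))).filter (fun G => G.edgeSet.ncard = m),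
      f (graphPairs G) = ∑ T ∈ (Finset.univ : Finset (Pairs n)).powersetCard m, f T := by
  have hinv : ∀ T : Finset (Pairs n),
      graphPairs (SimpleGraph.fromEdgeSet (Subtype.val '' (T : Set (Pairs n)))) = T := by
    intro T
    ext e
    rw [mem_graphPairs, SimpleGraph.edgeSet_fromEdgeSet]
    have := e.2
    simp
    tauto
  refine Finset.sum_bij' (fun G _ => graphPairs G)
    (fun T _ => SimpleGraph.fromEdgeSet (Subtype.val '' (T : Set (Pairs n)))) ?_ ?_ ?_ ?_ ?_
  · intro G hG
    rw [Finset.mem_powersetCard, card_graphPairs]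
    exact ⟨Finset.subset_univ _, (Finset.mem_filter.1 hG).2⟩
  · intro T hT
    rw [Finset.mem_filter, ← card_graphPairs, hinv]
    exact ⟨Finset.mem_univ _, (Finset.mem_powersetCard.1 hT).2⟩
  · intro G _
    rw [← SimpleGraph.edgeSet_inj, SimpleGraph.edgeSet_fromEdgeSet]
    ext e
    simp only [Set.mem_sdiff, Set.mem_image, SetLike.mem_coe, mem_graphPairs]
    constructor
    · rintro ⟨⟨a, ha, rfl⟩, -⟩
      exact ha
    · intro he
      exact ⟨⟨⟨e, G.not_isDiag_of_mem_edgeSet he⟩, he, rfl⟩, G.not_isDiag_of_mem_edgeSet he⟩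
  · intro T _
    exact hinv T
  · intro G _
    rfl

section Tail

variable {𝒳 : Type*} [MeasurableSpace 𝒳] (μ : Measure 𝒳) [IsProbabilityMeasure μ]
  {H : Type*} [NormedAddCommGroup H] [InnerProductSpace ℝ H]

theorem erdosRenyi_prod_pi_deviation_le {J : Type*} [Finite J] [Nonempty J]
    {l : J → 𝒳 × 𝒳 → ℝ} (hl : ∀ j, Measurable (l j)) (hl' : ∀ j z, l j z ∈ Set.Icc (0 : ℝ) 1)
    {w : J → H} (hw : ∀ j, ‖w j‖ ≤ 1) {Φ : 𝒳 × 𝒳 → H} {B : ℝ} (hB : ∀ z, ‖Φ z‖ ≤ B)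
    (hΦ : ∀ j, Measurable fun z => (inner ℝ (w j) (Φ z) : ℝ)) {L : ℝ} (hL : 0 ≤ L)
    (h : ∀ z i j, |l i z - l j z| ≤ L * |(inner ℝ (w i) (Φ z) : ℝ) - inner ℝ (w j) (Φ z)|)
    {n k m : ℕ} (hk : 0 < k) (hkn : 2 * k ≤ n) (hm : 0 < m) (hmn : m ≤ n.choose 2)
    {o : Sym2 (Fin n) → Fin n × Fin n} (ho : ∀ e, s((o e).1, (o e).2) = e) {s : ℝ} (hs : 0 ≤ s)
    (ε : ℝ) :
    ((erdosRenyi n m).prod (Measure.pi fun _ : Fin n => μ))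
      {p | ∃ j, ε < ∫ z, l j z ∂(μ.prod μ) -
        (∑ e ∈ graphPairs p.1, l j (p.2 (o e.1).1, p.2 (o e.1).2)) / (graphPairs p.1).card} ≤
      ENNReal.ofReal (Real.exp (-(s * ε) + (s * (2 * L * B / √k + 2 * L * B / √m) +
        s ^ 2 / 8 * (1 / k + 1 / m)))) := by
  classical
  have := measurableSingletonClass_simpleGraph n
  set Q := (Finset.univ : Finset (SimpleGraph (Fin n))).filter (fun G => G.edgeSet.ncard = m)
    with hQ
  have hER : erdosRenyi n m = uniformOn (Q : Set (SimpleGraph (Fin n))) := by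
    rw [erdosRenyi, hQ]; simp
  have hcard : (Q.card : ℝ) = ((Finset.univ : Finset (Pairs n)).powersetCard m).card := by
    have := sum_graphs_eq (n := n) m fun _ => 1
    simpa using this
  have hpos : 0 < Q.card := by
    have h1 : 0 < ((Finset.univ : Finset (Pairs n)).powersetCard m).card := by
      rw [Finset.card_powersetCard, Finset.card_univ, Sym2.card_subtype_not_diag, Fintype.card_fin]
      exact Nat.choose_pos hmn
    exact_mod_cast hcard ▸ (Nat.cast_pos (α := ℝ)).2 h1
  have hQne : Q.Nonempty := Finset.card_pos.1 hpos
  have hprob : IsProbabilityMeasure (erdosRenyi n m) := by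
    rw [hER]
    exact isProbabilityMeasure_uniformOn Q.finite_toSet (Finset.coe_nonempty.2 hQne)
  have hR := fun j => integral_mem_Icc (ν := μ.prod μ) (hl j) (hl' j)
  set F : SimpleGraph (Fin n) × (Fin n → 𝒳) → ℝ := fun p => Real.exp (s * ⨆ j,
    (∫ z, l j z ∂(μ.prod μ) -
      (∑ e ∈ graphPairs p.1, l j (p.2 (o e.1).1, p.2 (o e.1).2)) / (graphPairs p.1).card)) with hF
  have hFm : Measurable F := measurable_from_prod_countable_right fun G =>
    ((Measurable.iSup fun j => by dsimp only; fun_prop).const_mul s).exp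
  have hFint : Integrable F ((erdosRenyi n m).prod (Measure.pi fun _ : Fin n => μ)) :=
    Integrable.of_bound hFm.aestronglyMeasurable (Real.exp s)
      (ae_of_all _ fun p => exp_ciSup_sub_le (fun j => (hR j).2)
        (fun j => (average_mem_Icc (graphPairs p.1) (fun i => hl' j _) rfl).1) hs)
  have hFle : ∫ p, F p ∂((erdosRenyi n m).prod (Measure.pi fun _ : Fin n => μ)) ≤
      Real.exp (s * (2 * L * B / √k + 2 * L * B / √m) + s ^ 2 / 8 * (1 / k + 1 / m)) := by
    rw [integral_prod _ hFint, hER, integral_uniformOn_coe_finset hQne,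
      div_le_iff₀ (Nat.cast_pos.2 hpos), mul_comm, hcard]
    refine le_trans (le_of_eq ?_)
      (sum_integral_exp_ciSup_subset_le μ hl hl' hw hB hΦ hL h hk hkn hm ho hs)
    rw [hQ, sum_graphs_eq m fun T => ∫ x : Fin n → 𝒳, Real.exp (s * ⨆ j,
      (∫ z, l j z ∂(μ.prod μ) -
        (∑ e ∈ T, l j (x (o e.1).1, x (o e.1).2)) / T.card)) ∂(Measure.pi fun _ => μ)]
    refine Finset.sum_congr rfl fun T hT => ?_
    rw [(Finset.mem_powersetCard.1 hT).2]
  -- Chernoff: Markov's inequality for `F` at the level `exp(s * ε)`.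
  have hmarkov := mul_meas_ge_le_integral_of_nonneg
    (ae_of_all _ fun p => (Real.exp_pos _).le : 0 ≤ᵐ[(erdosRenyi n m).prod
      (Measure.pi fun _ : Fin n => μ)] F) hFint (Real.exp (s * ε))
  refine (measure_mono (t := {p | Real.exp (s * ε) ≤ F p}) ?_).trans ?_
  · rintro p ⟨j, hj⟩
    refine Real.exp_le_exp.2 (mul_le_mul_of_nonneg_left (hj.le.trans ?_) hs)
    exact le_ciSup_of_finite (fun j => ∫ z, l j z ∂(μ.prod μ) -
      (∑ e ∈ graphPairs p.1, l j (p.2 (o e.1).1, p.2 (o e.1).2)) / (graphPairs p.1).card) j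
  · rw [← ENNReal.ofReal_toReal (measure_ne_top _ _)]
    refine ENNReal.ofReal_le_ofReal ?_
    rw [Real.exp_add, Real.exp_neg, ← div_eq_inv_mul, le_div_iff₀ (Real.exp_pos _), mul_comm]
    exact hmarkov.trans hFle

end Tail

/-! ### Reduction to countably many hypotheses -/

/-- The functionals of norm at most one on the range of a strongly measurable map are uniformly
approximated by countably many. -/
theorem exists_seq_dense_unitBall {Z H : Type*} [MeasurableSpace Z] [NormedAddCommGroup H]
    [InnerProductSpace ℝ H] [CompleteSpace H] {Φ : Z → H} (hΦ : StronglyMeasurable Φ) {B : ℝ}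
    (hB : ∀ z, ‖Φ z‖ ≤ B) :
    ∃ w : ℕ → H, (∀ i, ‖w i‖ ≤ 1) ∧ ∀ v : H, ‖v‖ ≤ 1 → ∀ ε > 0, ∃ i, ∀ z,
      |(inner ℝ v (Φ z) : ℝ) - inner ℝ (w i) (Φ z)| ≤ ε := by
  -- `H` may be nonseparable, but the closed span of the range of a strongly measurable map is
  -- separable. Projecting onto it changes no value `⟪v, Φ z⟫` and does not increase the norm.
  set K : Submodule ℝ H := (Submodule.span ℝ (Set.range Φ)).topologicalClosure with hK
  have hKsep : TopologicalSpace.IsSeparable (K : Set H) := by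
    rw [hK, Submodule.topologicalClosure_coe]
    exact (hΦ.isSeparable_range.span).closure
  have hKc : IsClosed (K : Set H) := Submodule.isClosed_topologicalClosure _
  have : CompleteSpace K := hKc.completeSpace_coe
  have hΦK : ∀ z, Φ z ∈ K := fun z =>
    Submodule.le_topologicalClosure _ (Submodule.subset_span ⟨z, rfl⟩)
  set W : Set H := {v | v ∈ K ∧ ‖v‖ ≤ 1}
  have hWsep : TopologicalSpace.IsSeparable W := hKsep.mono fun v hv => hv.1
  have : TopologicalSpace.SeparableSpace W := hWsep.separableSpace
  have : Nonempty W := ⟨⟨0, K.zero_mem, by simp⟩⟩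
  refine ⟨fun i => (TopologicalSpace.denseSeq W i).1, fun i => (TopologicalSpace.denseSeq W i).2.2,
    fun v hv ε hε => ?_⟩
  have hv' : K.starProjection v ∈ W :=
    ⟨K.starProjection_apply_mem v, (K.norm_starProjection_apply_le v).trans hv⟩
  have hε' : 0 < ε / (|B| + 1) := by positivity
  obtain ⟨i, hi⟩ := (TopologicalSpace.denseRange_denseSeq W).exists_dist_lt ⟨_, hv'⟩ hε'
  refine ⟨i, fun z => ?_⟩
  have h1 : (inner ℝ v (Φ z) : ℝ) = inner ℝ (K.starProjection v) (Φ z) := by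
    rw [Submodule.inner_starProjection_left_eq_right, K.starProjection_eq_self_iff.2 (hΦK z)]
  rw [h1, ← inner_sub_left]
  rw [Subtype.dist_eq, dist_eq_norm] at hi
  calc |(inner ℝ (K.starProjection v - (TopologicalSpace.denseSeq W i).1) (Φ z) : ℝ)|
      ≤ ‖K.starProjection v - (TopologicalSpace.denseSeq W i).1‖ * ‖Φ z‖ :=
        abs_real_inner_le_norm _ _
    _ ≤ ε / (|B| + 1) * (|B| + 1) :=
        mul_le_mul hi.le ((hB z).trans ((le_abs_self B).trans (by linarith))) (norm_nonneg _) hε'.le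
    _ = ε := by field_simp

/-! ### Numerical constants and the rate -/

theorem one_le_samplingConst (n m : ℕ) (δ : ℝ) : 1 ≤ samplingConst n m δ := by
  unfold samplingConst
  linarith [Real.sqrt_nonneg (3 * (n : ℝ) / (2 * (m : ℝ)) * Real.log (2 * (n : ℝ) / δ))]

/-- For odd `n = 2k+1`, integrality improves `m ≥ n/2` to `m ≥ k+1`, and `1/k + 1/(k+1)` equals the
right side. For even `n` the left side is at most `4/n`. -/
theorem inv_half_add_inv_le {n m : ℕ} (hn : 2 ≤ n) (hm : (n : ℝ) / 2 ≤ m) :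
    (1 : ℝ) / (n / 2 : ℕ) + 1 / m ≤ 4 * n * (1 / ((n : ℝ) ^ 2 - 1)) := by
  have hnm : n ≤ 2 * m := by
    have : (n : ℝ) ≤ 2 * m := by linarith
    exact_mod_cast this
  obtain ⟨k, rfl | rfl⟩ := Nat.even_or_odd' n
  · have hk : 1 ≤ k := by omega
    have hk' : (1 : ℝ) ≤ k := by exact_mod_cast hk
    have hmk : (k : ℝ) ≤ m := by exact_mod_cast (show k ≤ m by omega)
    rw [Nat.mul_div_cancel_left k two_pos]
    have h1 : (1 : ℝ) / m ≤ 1 / k := one_div_le_one_div_of_le (by linarith) hmk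
    have h2 : (1 : ℝ) / k + 1 / k ≤ 4 * (2 * k : ℕ) * (1 / (((2 * k : ℕ) : ℝ) ^ 2 - 1)) := by
      push_cast
      have h3 : (0 : ℝ) < (2 * k) ^ 2 - 1 := by nlinarith
      rw [← add_div, mul_one_div, div_le_div_iff₀ (by linarith) h3]
      nlinarith
    linarith
  · have hk : 1 ≤ k := by omega
    have hk' : (1 : ℝ) ≤ k := by exact_mod_cast hk
    have hmk : (k : ℝ) + 1 ≤ m := by exact_mod_cast (show k + 1 ≤ m by omega)
    have h0 : (2 * k + 1) / 2 = k := by omega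
    rw [h0]
    have h1 : (1 : ℝ) / m ≤ 1 / (k + 1) := one_div_le_one_div_of_le (by linarith) hmk
    have h2 : (1 : ℝ) / k + 1 / (k + 1) =
        4 * (2 * k + 1 : ℕ) * (1 / (((2 * k + 1 : ℕ) : ℝ) ^ 2 - 1)) := by
      push_cast
      have h3 : ((2 * k + 1 : ℝ) ^ 2 - 1) = 4 * k * (k + 1) := by ring
      rw [h3]
      field_simp
      ring
    linarith

/-- The loss in the constants caused by an odd number of instances is absorbed by the difference
between `ln (2 / δ)` and `ln (1 / δ)`. -/
theorem sqrt_add_le_sqrt {N a S u : ℝ} (hN : 2 ≤ N) (ha : 0 ≤ a)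
    (hS : S ≤ 4 * N * (1 / (N ^ 2 - 1))) (hu0 : 0 ≤ u) (hu1 : u ≤ 1)
    (hq : √(2 / N * (a + Real.log 2)) ≤ 1) :
    √(S / 2 * a) + u * (1 / 2 + N * S / 8) ≤ u + √(2 / N * (a + Real.log 2)) := by
  have hl := Real.log_two_gt_d9
  have hN0 : 0 < N := by linarith
  have hNN : 0 < N ^ 2 - 1 := by nlinarith
  set D := 1 / (N ^ 2 - 1) with hD
  have hD0 : 0 < D := by positivity
  have hD1 : D * (N ^ 2 - 1) = 1 := by rw [hD]; field_simp
  have hb : (N - 1) * D ≤ 1 / 3 := by nlinarith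
  have hc : N * D ≤ 2 / 3 := by
    rw [hD, mul_one_div, div_le_iff₀ hNN]; nlinarith
  have hD3 : D ≤ 1 / 3 := by nlinarith
  -- From `q ≤ 1` one gets `a ≤ N/2 - ln 2`, and `ln 2 > 1/2`.
  have ha1 : a ≤ (N - 1) / 2 := by
    have h1 := (Real.sqrt_le_one.1 hq)
    rw [div_mul_eq_mul_div, div_le_one hN0] at h1
    linarith
  have h1 : √(S / 2 * a) ≤ √(2 * N * D * a) := by
    apply Real.sqrt_le_sqrt
    refine mul_le_mul_of_nonneg_right ?_ ha
    linarith
  set r := √(2 * N * D * a) with hr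
  have hr2 : r ^ 2 = 2 * N * D * a := Real.sq_sqrt (by positivity)
  have hr0 : 0 ≤ r := Real.sqrt_nonneg _
  have hr1 : r ≤ 1 := by
    have h3 : 2 * N * D * a ≤ 1 := by
      have : 2 * N * D * a ≤ 2 * N * D * ((N - 1) / 2) :=
        mul_le_mul_of_nonneg_left ha1 (by positivity)
      nlinarith
    nlinarith
  have h2 : u * (1 / 2 + N * S / 8) ≤ u + D / 2 := by
    have h3 : N * S / 8 ≤ 1 / 2 + D / 2 := by
      have : N * S ≤ N * (4 * N * D) := mul_le_mul_of_nonneg_left hS hN0.le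
      nlinarith
    nlinarith
  have h3 : r + D / 2 ≤ √(2 / N * (a + Real.log 2)) := by
    apply Real.le_sqrt_of_sq_le
    rw [div_mul_eq_mul_div, le_div_iff₀ hN0]
    -- Beyond `2a` the three error terms are at most `1/3`, `2/3` and `1/18`; their sum is below `2
    -- ln 2`.
    have e1 : (r + D / 2) ^ 2 * N = r ^ 2 * N + r * (N * D) + D * (N * D) / 4 := by ring
    have e2 : r ^ 2 * N = 2 * a * (D * (N ^ 2 - 1)) + 2 * a * D := by rw [hr2]; ring
    have e3 : 2 * a * D ≤ 1 / 3 := by nlinarith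
    have e4 : r * (N * D) ≤ 2 / 3 := by nlinarith [mul_pos hN0 hD0]
    have e5 : D * (N * D) ≤ 2 / 9 := by nlinarith [mul_pos hN0 hD0]
    rw [e1, e2, hD1]
    linarith
  linarith

theorem exists_exponent {n m : ℕ} (hn : 2 ≤ n) (hm : (n : ℝ) / 2 ≤ m) {B γ δ : ℝ} (hB : 0 ≤ B)
    (hγ : 0 < γ) (hδ : 0 < δ) (hδ' : δ < 1) (he : riskExcess B γ δ n m ≤ 1) :
    ∃ s : ℝ, 0 ≤ s ∧ -(s * riskExcess B γ δ n m) +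
      (s * (2 * (1 / γ) * B / √(n / 2 : ℕ) + 2 * (1 / γ) * B / √m) +
        s ^ 2 / 8 * (1 / (n / 2 : ℕ) + 1 / m)) ≤ Real.log δ := by
  have hN : (2 : ℝ) ≤ n := by exact_mod_cast hn
  have hN0 : (0 : ℝ) < n := by linarith
  have hM0 : (0 : ℝ) < m := by linarith
  have hK0 : (0 : ℝ) < (n / 2 : ℕ) := by exact_mod_cast Nat.div_pos hn two_pos
  set k : ℝ := ((n / 2 : ℕ) : ℝ) with hk
  set M : ℝ := (m : ℝ) with hMdef
  set N : ℝ := (n : ℝ) with hNdef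
  have hS := inv_half_add_inv_le hn hm
  rw [← hk, ← hMdef, ← hNdef] at hS
  set S := 1 / k + 1 / M with hSdef
  have hS0 : 0 < S := by positivity
  set a := -Real.log δ with ha
  have ha0 : 0 < a := neg_pos.2 (Real.log_neg hδ hδ')
  have hlog : Real.log (2 / δ) = a + Real.log 2 := by
    rw [Real.log_div two_ne_zero hδ.ne', ha]; ring
  set u := √32 * B / (γ * √N) with hu
  have hu0 : 0 ≤ u := by positivity
  set q := √(2 / N * (a + Real.log 2)) with hq
  have hqe : u + q ≤ riskExcess B γ δ n m := by
    unfold riskExcess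
    rw [hlog]
    refine add_le_add le_rfl (Real.sqrt_le_sqrt (mul_le_mul_of_nonneg_right ?_ ?_))
    · exact div_le_div_of_nonneg_right (by linarith [one_le_samplingConst n m δ]) hN0.le
    · linarith [Real.log_pos one_lt_two]
  have hq0 : 0 ≤ q := Real.sqrt_nonneg _
  have key := sqrt_add_le_sqrt hN ha0.le hS hu0 (by linarith) (by linarith)
  -- The left side is `u/2` times `√(N/(2x))`, and `√y ≤ (1+y)/2`. This is sharp at `x = N/2`, which
  -- is where `√32` comes from: two such terms add up to `u`.
  have hterm : ∀ x : ℝ, 0 < x → 2 * (1 / γ) * B / √x ≤ u * (1 + N / (2 * x)) / 4 := by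
    intro x hx
    have h32 : √32 = 4 * √2 := by
      rw [show (32 : ℝ) = 4 ^ 2 * 2 by norm_num, Real.sqrt_mul (by norm_num),
        Real.sqrt_sq (by norm_num)]
    have hsx := Real.sqrt_pos.2 hx
    have hsN := Real.sqrt_pos.2 hN0
    have hs2 : 0 < √(2 : ℝ) := by positivity
    have q1 := Real.sq_sqrt hx.le
    have q2 := Real.sq_sqrt hN0.le
    have q3 := Real.sq_sqrt (zero_le_two (α := ℝ))
    have h1 : 2 * (1 / γ) * B / √x = u * (√N / (√2 * √x)) / 2 := by
      rw [hu, h32]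
      field_simp
      nlinarith
    have h2 : √N / (√2 * √x) ≤ (1 + N / (2 * x)) / 2 := by
      have h3 : N / (2 * x) = (√N / (√2 * √x)) ^ 2 := by
        rw [div_pow, mul_pow, q1, q2, q3]
      rw [h3]
      nlinarith [sq_nonneg (√N / (√2 * √x) - 1)]
    rw [h1]
    have := mul_le_mul_of_nonneg_left h2 hu0
    linarith
  have hb : 2 * (1 / γ) * B / √k + 2 * (1 / γ) * B / √M ≤ u * (1 / 2 + N * S / 8) := by
    refine (add_le_add (hterm k hK0) (hterm M hM0)).trans_eq ?_
    rw [hSdef]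
    field_simp
    ring
  set b := 2 * (1 / γ) * B / √k + 2 * (1 / γ) * B / √M with hbdef
  set e := riskExcess B γ δ n m with hedef
  have ht : √(S / 2 * a) ≤ e - b := by linarith
  have ht0 : 0 ≤ e - b := (Real.sqrt_nonneg _).trans ht
  -- The minimizer of `s²S/8 - s(e - b)`, with minimum `-2(e - b)²/S`.
  refine ⟨4 * (e - b) / S, by positivity, ?_⟩
  have h4 : S / 2 * a ≤ (e - b) ^ 2 := (Real.sqrt_le_left ht0).1 ht
  have h5 : -(4 * (e - b) / S * e) + (4 * (e - b) / S * b + (4 * (e - b) / S) ^ 2 / 8 * S) =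
      -(2 * (e - b) ^ 2 / S) := by
    field_simp
    ring
  rw [h5, show Real.log δ = -a by rw [ha, neg_neg], neg_le_neg_iff, le_div_iff₀ hS0]
  linarith

/-- For `m ≥ n/2` the factor `3n/(2m)` is at most `3`, so `C + 1 = O(√(ln n))`; the outer root gives
the power `1/4`. Since `ln n ≥ ln 2`, the constants are absorbed too. -/
theorem riskExcess_le_rate {B γ δ : ℝ} (hB : 0 ≤ B) (hγ : 0 < γ) (hδ : 0 < δ) (hδ' : δ < 1) :
    ∃ c : ℝ, ∀ n m : ℕ, 2 ≤ n → (n : ℝ) / 2 ≤ (m : ℝ) →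
      riskExcess B γ δ n m ≤ c * Real.log (n : ℝ) ^ (1 / 4 : ℝ) / √(n : ℝ) := by
  set A := Real.log (2 / δ) with hA
  have hA0 : 0 < A := Real.log_pos (by rw [lt_div_iff₀ hδ]; linarith)
  have hl2 := Real.log_pos one_lt_two
  set ρ := Real.log 2 ^ (1 / 4 : ℝ) with hρ
  have hρ0 : 0 < ρ := Real.rpow_pos_of_pos hl2 _
  set K := 2 / √(Real.log 2) + √(3 * (1 + A / Real.log 2)) with hK
  have hK0 : 0 ≤ K := by positivity
  refine ⟨√32 * B / γ / ρ + √(K * A), fun n m hn hm => ?_⟩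
  have hN : (2 : ℝ) ≤ n := by exact_mod_cast hn
  have hN0 : (0 : ℝ) < n := by linarith
  have hM0 : (0 : ℝ) < m := by linarith
  set N : ℝ := (n : ℝ) with hNdef
  set Λ := Real.log N with hΛ
  have hΛ2 : Real.log 2 ≤ Λ := Real.log_le_log two_pos hN
  have hΛ0 : 0 < Λ := hl2.trans_le hΛ2
  set R := Λ ^ (1 / 4 : ℝ) with hR
  have hR0 : 0 < R := Real.rpow_pos_of_pos hΛ0 _
  have hρR : ρ ≤ R := Real.rpow_le_rpow hl2.le hΛ2 (by norm_num)
  have hRR : √(√Λ) = R := by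
    rw [Real.sqrt_eq_rpow, Real.sqrt_eq_rpow, ← Real.rpow_mul hΛ0.le, hR]; norm_num
  have hsN := Real.sqrt_pos.2 hN0
  have h1 : √32 * B / (γ * √N) ≤ √32 * B / γ / ρ * R / √N := by
    have : √32 * B / (γ * √N) = √32 * B / γ * 1 / √N := by field_simp
    rw [this]
    refine div_le_div_of_nonneg_right ?_ hsN.le
    rw [show √32 * B / γ / ρ * R = √32 * B / γ * (R / ρ) by ring]
    exact mul_le_mul_of_nonneg_left ((one_le_div hρ0).2 hρR) (by positivity)
  have h2 : samplingConst n m δ + 1 ≤ K * √Λ := by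
    unfold samplingConst
    have h3 : Real.log (2 * N / δ) = Λ + A := by
      rw [show 2 * N / δ = N * (2 / δ) by ring, Real.log_mul hN0.ne' (by positivity)]
    have h4 : 3 * N / (2 * m) ≤ 3 := by
      rw [div_le_iff₀ (by positivity)]; linarith
    have h5 : 3 * N / (2 * m) * (Λ + A) ≤ 3 * (1 + A / Real.log 2) * Λ := by
      refine (mul_le_mul_of_nonneg_right h4 (by positivity)).trans ?_
      have : A ≤ A / Real.log 2 * Λ := by
        rw [div_mul_eq_mul_div, le_div_iff₀ hl2]
        exact mul_le_mul_of_nonneg_left hΛ2 hA0.le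
      linarith
    have h6 : √(3 * N / (2 * m) * (Λ + A)) ≤ √(3 * (1 + A / Real.log 2)) * √Λ := by
      rw [← Real.sqrt_mul (by positivity)]
      exact Real.sqrt_le_sqrt h5
    have h7 : 2 ≤ 2 / √(Real.log 2) * √Λ := by
      rw [div_mul_eq_mul_div, le_div_iff₀ (Real.sqrt_pos.2 hl2)]
      exact mul_le_mul_of_nonneg_left (Real.sqrt_le_sqrt hΛ2) zero_le_two
    rw [h3, hK, add_mul]
    linarith
  have h3 : √((samplingConst n m δ + 1) / N * A) ≤ √(K * A) * R / √N := by
    rw [← hRR, ← Real.sqrt_mul (by positivity), ← Real.sqrt_div (by positivity)]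
    refine Real.sqrt_le_sqrt ?_
    rw [div_mul_eq_mul_div]
    refine div_le_div_of_nonneg_right ?_ hN0.le
    linarith [mul_le_mul_of_nonneg_right h2 hA0.le]
  unfold riskExcess
  refine (add_le_add h1 h3).trans_eq ?_
  ring

/-! ### The ramp cost and the uniform risk bound -/

theorem rampCost_mem_Icc (γ y u : ℝ) : rampCost γ y u ∈ Set.Icc (0 : ℝ) 1 :=
  ⟨le_min (le_max_left _ _) zero_le_one, min_le_right _ _⟩

theorem abs_rampCost_sub_le {γ y : ℝ} (hγ : 0 < γ) (hy : y = 1 ∨ y = -1) (u v : ℝ) :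
    |rampCost γ y u - rampCost γ y v| ≤ 1 / γ * |u - v| := by
  have h1 : |(1 - y * u / γ) - (1 - y * v / γ)| = 1 / γ * |u - v| := by
    have : (1 - y * u / γ) - (1 - y * v / γ) = -(y * (1 / γ) * (u - v)) := by ring
    rw [this, abs_neg, abs_mul, abs_mul, abs_of_pos (one_div_pos.2 hγ)]
    rcases hy with rfl | rfl <;> simp
  rw [← h1]
  unfold rampCost
  refine (abs_min_sub_min_le_max _ _ _ _).trans ?_
  rw [sub_self, abs_zero]
  refine max_le ?_ (abs_nonneg _)
  refine (abs_max_sub_max_le_max _ _ _ _).trans ?_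
  rw [sub_self, abs_zero]
  exact max_le (abs_nonneg _) le_rfl

theorem measurable_rampCost (γ : ℝ) {Z : Type*} [MeasurableSpace Z] {r f : Z → ℝ}
    (hr : Measurable r) (hf : Measurable f) : Measurable fun z => rampCost γ (r z) (f z) := by
  unfold rampCost
  fun_prop

theorem zeroOneCost_nonneg (y u : ℝ) : 0 ≤ zeroOneCost y u := by
  unfold zeroOneCost
  split_ifs <;> norm_num

theorem zeroOneCost_le_rampCost {γ y : ℝ} (hγ : 0 < γ) (hy : y = 1 ∨ y = -1) (u : ℝ) :
    zeroOneCost y u ≤ rampCost γ y u := by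
  unfold zeroOneCost
  split_ifs with h
  · exact (rampCost_mem_Icc _ _ _).1
  · have hyu : y * u ≤ 0 := by
      rcases lt_trichotomy u 0 with hu | rfl | hu
      · rw [Real.sign_of_neg hu] at h
        rcases hy with rfl | rfl
        · linarith
        · exact absurd rfl h
      · simp
      · rw [Real.sign_of_pos hu] at h
        rcases hy with rfl | rfl
        · exact absurd rfl h
        · linarith
    have : y * u / γ ≤ 0 := div_nonpos_of_nonpos_of_nonneg hyu hγ.le
    exact le_min (le_max_of_le_right (by linarith)) le_rfl

theorem empRampRisk_trainingSet {𝒳 : Type*} (γ : ℝ) {n : ℕ} (r h : 𝒳 × 𝒳 → ℝ)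
    (o : Sym2 (Fin n) → Fin n × Fin n) (G : SimpleGraph (Fin n)) (x : Fin n → 𝒳) :
    empRampRisk γ (trainingSet r o G x) h =
      (∑ e ∈ graphPairs G, rampCost γ (r (x (o e.1).1, x (o e.1).2))
        (h (x (o e.1).1, x (o e.1).2))) / (graphPairs G).card := by
  classical
  unfold empRampRisk trainingSet
  rw [Multiset.map_map, Multiset.card_map, ← map_graphPairs]
  congr 1
  · exact Finset.sum_map _ _ _
  · rw [Finset.card_val, Finset.card_map]

section Risk

variable {𝒳 : Type*} [MeasurableSpace 𝒳] (μ : Measure 𝒳) [IsProbabilityMeasure μ]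
  {r : 𝒳 × 𝒳 → ℝ} (hr : Measurable r) (hr' : ∀ z, r z = 1 ∨ r z = -1) {γ : ℝ} (hγ : 0 < γ)

include hr hr' hγ

theorem zeroOneRisk_le_integral_rampCost {h : 𝒳 × 𝒳 → ℝ} (hh : Measurable h) :
    zeroOneRisk μ r h ≤ ∫ z, rampCost γ (r z) (h z) ∂(μ.prod μ) := by
  refine integral_mono_of_nonneg (ae_of_all _ fun z => zeroOneCost_nonneg _ _) ?_
    (ae_of_all _ fun z => zeroOneCost_le_rampCost hγ (hr' z) _)
  exact Integrable.of_mem_Icc 0 1 (measurable_rampCost γ hr hh).aemeasurable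
    (ae_of_all _ fun z => rampCost_mem_Icc _ _ _)

theorem abs_integral_rampCost_sub_le {f g : 𝒳 × 𝒳 → ℝ} (hf : Measurable f) (hg : Measurable g)
    {ε : ℝ} (hfg : ∀ z, |f z - g z| ≤ ε) :
    |∫ z, rampCost γ (r z) (f z) ∂(μ.prod μ) - ∫ z, rampCost γ (r z) (g z) ∂(μ.prod μ)| ≤
      1 / γ * ε := by
  rw [← integral_sub]
  · have := norm_integral_le_of_norm_le_const (μ := μ.prod μ)
      (f := fun z => rampCost γ (r z) (f z) - rampCost γ (r z) (g z)) (C := 1 / γ * ε)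
      (ae_of_all _ fun z => (abs_rampCost_sub_le hγ (hr' z) _ _).trans
        (mul_le_mul_of_nonneg_left (hfg z) (one_div_pos.2 hγ).le))
    simpa using this
  · exact Integrable.of_mem_Icc 0 1 (measurable_rampCost γ hr hf).aemeasurable
      (ae_of_all _ fun z => rampCost_mem_Icc _ _ _)
  · exact Integrable.of_mem_Icc 0 1 (measurable_rampCost γ hr hg).aemeasurable
      (ae_of_all _ fun z => rampCost_mem_Icc _ _ _)

/-- The uniform risk bound over the whole class of kernel hypotheses. -/
theorem erdosRenyi_prod_pi_uniform_deviation_le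
    {H : Type*} [NormedAddCommGroup H] [InnerProductSpace ℝ H] [CompleteSpace H]
    {Φ : 𝒳 × 𝒳 → H} (hΦ : StronglyMeasurable Φ) {B : ℝ} (hB : ∀ z, ‖Φ z‖ ≤ B)
    {δ : ℝ} (hδ : 0 < δ) (hδ' : δ < 1) {n m : ℕ} (hn : 2 ≤ n) (hm : (n : ℝ) / 2 ≤ (m : ℝ))
    (hmn : m ≤ n.choose 2) {o : Sym2 (Fin n) → Fin n × Fin n}
    (ho : ∀ e, s((o e).1, (o e).2) = e) (he : riskExcess B γ δ n m ≤ 1) :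
    ((erdosRenyi n m).prod (Measure.pi fun _ : Fin n => μ))
      {p | ∃ v : H, ‖v‖ ≤ 1 ∧ riskExcess B γ δ n m <
        ∫ z, rampCost γ (r z) (inner ℝ v (Φ z)) ∂(μ.prod μ) -
          (∑ e ∈ graphPairs p.1, rampCost γ (r (p.2 (o e.1).1, p.2 (o e.1).2))
            (inner ℝ v (Φ (p.2 (o e.1).1, p.2 (o e.1).2)))) / (graphPairs p.1).card} ≤
      ENNReal.ofReal δ := by
  have h𝒳 : Nonempty 𝒳 := nonempty_of_isProbabilityMeasure μ
  have hB0 : 0 ≤ B := (norm_nonneg _).trans (hB (h𝒳.some, h𝒳.some))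
  have hm0 : 0 < m := by
    have : (0 : ℝ) < m := lt_of_lt_of_le (by positivity) hm
    exact_mod_cast this
  obtain ⟨s, hs0, hs⟩ := exists_exponent hn hm hB0 hγ hδ hδ' he
  set ε := riskExcess B γ δ n m
  obtain ⟨w, hw, hdense⟩ := exists_seq_dense_unitBall hΦ hB
  have hmeas : ∀ v : H, Measurable fun z => (inner ℝ v (Φ z) : ℝ) := fun v =>
    (stronglyMeasurable_const.inner hΦ).measurable
  set D : H → SimpleGraph (Fin n) × (Fin n → 𝒳) → ℝ := fun v p =>
    ∫ z, rampCost γ (r z) (inner ℝ v (Φ z)) ∂(μ.prod μ) -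
      (∑ e ∈ graphPairs p.1, rampCost γ (r (p.2 (o e.1).1, p.2 (o e.1).2))
        (inner ℝ v (Φ (p.2 (o e.1).1, p.2 (o e.1).2)))) / (graphPairs p.1).card with hD
  set V : ℕ → Set (SimpleGraph (Fin n) × (Fin n → 𝒳)) := fun k =>
    {p | ∃ j : Fin (k + 1), ε < D (w j) p} with hV
  have hVmono : Monotone V := by
    rintro a b hab p ⟨j, hj⟩
    exact ⟨⟨j, by omega⟩, hj⟩
  have hVle : ∀ k, ((erdosRenyi n m).prod (Measure.pi fun _ : Fin n => μ)) (V k) ≤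
      ENNReal.ofReal δ := by
    intro k
    refine (erdosRenyi_prod_pi_deviation_le μ (J := Fin (k + 1))
      (l := fun j z => rampCost γ (r z) (inner ℝ (w j) (Φ z)))
      (fun j => measurable_rampCost γ hr (hmeas _)) (fun j z => rampCost_mem_Icc _ _ _)
      (w := fun j => w j) (fun j => hw j) hB (fun j => hmeas _) (one_div_pos.2 hγ).le
      (fun z i j => abs_rampCost_sub_le hγ (hr' z) _ _) (Nat.div_pos hn two_pos)
      (Nat.mul_div_le n 2) hm0 hmn ho hs0 ε).trans ?_
    refine ENNReal.ofReal_le_ofReal ?_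
    rw [← Real.le_log_iff_exp_le hδ]
    exact hs
  have hsub : {p | ∃ v : H, ‖v‖ ≤ 1 ∧ ε < D v p} ⊆ ⋃ k, V k := by
    rintro p ⟨v, hv, hp⟩
    -- Risk and empirical risk each move by at most a quarter of the surplus over `ε`, so half of it
    -- survives at `w i`.
    have hη : 0 < γ * ((D v p - ε) / 4) := mul_pos hγ (by linarith)
    obtain ⟨i, hi⟩ := hdense v hv _ hη
    refine Set.mem_iUnion.2 ⟨i, Fin.last i, ?_⟩
    have h1 := abs_integral_rampCost_sub_le μ hr hr' hγ (hmeas v) (hmeas (w i)) hi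
    have h2 : |(∑ e ∈ graphPairs p.1, rampCost γ (r (p.2 (o e.1).1, p.2 (o e.1).2))
          (inner ℝ v (Φ (p.2 (o e.1).1, p.2 (o e.1).2)))) / (graphPairs p.1).card -
        (∑ e ∈ graphPairs p.1, rampCost γ (r (p.2 (o e.1).1, p.2 (o e.1).2))
          (inner ℝ (w i) (Φ (p.2 (o e.1).1, p.2 (o e.1).2)))) / (graphPairs p.1).card| ≤
        1 / γ * (γ * ((D v p - ε) / 4)) := by
      have hnn : 0 ≤ 1 / γ * (γ * ((D v p - ε) / 4)) := mul_nonneg (one_div_pos.2 hγ).le hη.le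
      rw [← sub_div, ← Finset.sum_sub_distrib, abs_div, Nat.abs_cast]
      refine div_le_of_le_mul₀ (Nat.cast_nonneg _) hnn ?_
      refine (Finset.abs_sum_le_sum_abs _ _).trans ?_
      refine (Finset.sum_le_card_nsmul _ _ (1 / γ * (γ * ((D v p - ε) / 4))) fun e _ =>
        (abs_rampCost_sub_le hγ (hr' _) _ _).trans
        (mul_le_mul_of_nonneg_left (hi _) (one_div_pos.2 hγ).le)).trans_eq ?_
      rw [nsmul_eq_mul, mul_comm]
    have h3 : 1 / γ * (γ * ((D v p - ε) / 4)) = (D v p - ε) / 4 := by field_simp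
    rw [h3] at h1 h2
    have h4 := (abs_le.1 h1).2
    have h5 := (abs_le.1 h2).1
    have h6 : D v p - D (w i) p ≤ (D v p - ε) / 2 := by
      simp only [hD] at h4 h5 ⊢
      linarith
    change ε < D (w i) p
    linarith
  refine (measure_mono hsub).trans ?_
  -- Continuity from below along an increasing sequence needs no measurability of the sets, so the
  -- same bound `δ` passes to the union.
  rw [hVmono.measure_iUnion]
  exact iSup_le hVle

end Risk

end BinaryRelation

/-! ### The learned hypothesis -/

theorem mainTheorem5
    {𝒳 : Type*} [MeasurableSpace 𝒳]
    (μ : MeasureTheory.Measure 𝒳) [MeasureTheory.IsProbabilityMeasure μ]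
    {H : Type*} [NormedAddCommGroup H] [InnerProductSpace ℝ H] [CompleteSpace H]
    (Φ : 𝒳 × 𝒳 → H) (hΦ : MeasureTheory.StronglyMeasurable Φ)
    (B : ℝ) (hB : ∀ z, ‖Φ z‖ ≤ B)
    (r : 𝒳 × 𝒳 → ℝ) (hr : Measurable r) (hr' : ∀ z, r z = 1 ∨ r z = -1)
    (A : Multiset ((𝒳 × 𝒳) × ℝ) → 𝒳 × 𝒳 → ℝ)
    (hA : ∀ D, A D ∈ BinaryRelation.kernelHypotheses Φ)
    (γ : ℝ) (hγ : 0 < γ) (δ : ℝ) (hδ : 0 < δ) (hδ' : δ < 1) :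
    (∀ n m : ℕ, 2 ≤ n → (n : ℝ) / 2 ≤ (m : ℝ) → m ≤ n.choose 2 →
      ∀ o : Sym2 (Fin n) → Fin n × Fin n, (∀ e, s((o e).1, (o e).2) = e) →
        ((BinaryRelation.erdosRenyi n m).prod (MeasureTheory.Measure.pi fun _ : Fin n => μ))
          {p | ¬ (BinaryRelation.zeroOneRisk μ r (A (BinaryRelation.trainingSet r o p.1 p.2)) ≤
                BinaryRelation.empRampRisk γ (BinaryRelation.trainingSet r o p.1 p.2)
                    (A (BinaryRelation.trainingSet r o p.1 p.2)) +
                  BinaryRelation.riskExcess B γ δ n m)}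
          ≤ ENNReal.ofReal δ) ∧
    (∃ c : ℝ, ∀ n m : ℕ, 2 ≤ n → (n : ℝ) / 2 ≤ (m : ℝ) →
      BinaryRelation.riskExcess B γ δ n m ≤
        c * Real.log (n : ℝ) ^ (1 / 4 : ℝ) / √(n : ℝ)) := by
  have h𝒳 : Nonempty 𝒳 := MeasureTheory.nonempty_of_isProbabilityMeasure μ
  have hB0 : 0 ≤ B := (norm_nonneg _).trans (hB (h𝒳.some, h𝒳.some))
  refine ⟨fun n m hn hm hmn o ho => ?_, BinaryRelation.riskExcess_le_rate hB0 hγ hδ hδ'⟩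
  have hmeas : ∀ {h : 𝒳 × 𝒳 → ℝ} {w : H}, (∀ z, h z = inner ℝ w (Φ z)) → Measurable h := by
    intro h w hw
    rw [funext hw]
    exact (MeasureTheory.stronglyMeasurable_const.inner hΦ).measurable
  by_cases he : BinaryRelation.riskExcess B γ δ n m ≤ 1
  · refine (MeasureTheory.measure_mono ?_).trans
      (BinaryRelation.erdosRenyi_prod_pi_uniform_deviation_le μ hr hr' hγ hΦ hB hδ hδ' hn hm hmn
        ho he)
    intro p hp
    obtain ⟨w, hw1, hw⟩ := hA (BinaryRelation.trainingSet r o p.1 p.2)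
    refine ⟨w, hw1, ?_⟩
    have h1 := BinaryRelation.zeroOneRisk_le_integral_rampCost μ hr hr' hγ (hmeas hw)
    rw [Set.mem_ofPred_eq, not_le, BinaryRelation.empRampRisk_trainingSet] at hp
    simp only [hw] at h1 hp
    linarith
  -- An excess above `1` exceeds any risk, and the empirical risk is nonnegative: the bad event is
  -- empty.
  · refine (MeasureTheory.measure_mono (t := ∅) fun p hp => (hp ?_).elim).trans (by simp)
    obtain ⟨w, -, hw⟩ := hA (BinaryRelation.trainingSet r o p.1 p.2)
    have h1 := BinaryRelation.zeroOneRisk_le_integral_rampCost μ hr hr' hγ (hmeas hw)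
    have h2 := (BinaryRelation.integral_mem_Icc (ν := μ.prod μ)
      (BinaryRelation.measurable_rampCost γ hr (hmeas hw))
      fun z => BinaryRelation.rampCost_mem_Icc _ _ _).2
    rw [BinaryRelation.empRampRisk_trainingSet]
    have h3 := (BinaryRelation.average_mem_Icc (BinaryRelation.graphPairs p.1)
      (fun e => BinaryRelation.rampCost_mem_Icc γ (r (p.2 (o e.1).1, p.2 (o e.1).2))
        (A (BinaryRelation.trainingSet r o p.1 p.2) (p.2 (o e.1).1, p.2 (o e.1).2))) rfl).1
    linarith
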